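/- **Theorem 1.** Let $0<p<1$. Consider the discrete-time totally asymmetric simple exclusion process on $\mathbb{Z}$ with parallel update: $x_i(t)\in\mathbb{Z}$ is the position at time $t\in\{0,1,2,\ldots\}$ of the particle with label $i\in\mathbb{Z}$; at each time step all particles are updated simultaneously, and each particle whose right neighbour site is empty (before the update) jumps to that site with probability $p$, independently of all other particles and times, and otherwise stays where it is. The initial condition is $x_i(0)=-2i$, $i\in\mathbb{Z}$. For pairs in $\mathbb{Z}\times\mathbb{Z}_{\ge 0}$ (particle label, time) write $(n,t)\prec(n',t')$ if $n\le n'$, $t'\le t$ and $(n,t)\neq(n',t')$. Let $m\ge 0$, let $(n_1,t_1)\prec(n_2,t_2)\prec\cdots\prec(n_m,t_m)$ be a space-like sequence, and let $a_1,\ldots,a_m\in\mathbb{Z}$. Then $$\mathbb{P}\Big(\bigcap_{k=1}^m\{x_{n_k}(t_k)\ge a_k\}\Big)=\det(\mathbb{1}-\chi K\chi)_{\ell^2(\{(n_1,t_1),\ldots,(n_m,t_m)\}\times\mathbb{Z})},$$ where $\chi((n_k,t_k),x)=\mathbb{1}(x<a_k)$ and, for two points $(n_1,t_1),x_1$ and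 $(n_2,t_2),x_2$, $$K((n_1,t_1),x_1;(n_2,t_2),x_2)=-\phi^{((n_1,t_1),(n_2,t_2))}(x_1,x_2)\,\mathbb{1}_{[(n_1,t_1)\prec(n_2,t_2)]}+\widetilde K((n_1,t_1),x_1;(n_2,t_2),x_2),$$ $$\widetilde K((n_1,t_1),x_1;(n_2,t_2),x_2)=\frac{-1}{2\pi \mathrm{i}}\oint_{\Gamma_0}dz\,\frac{(1+z)^{x_2+n_1+n_2}}{(-z)^{x_1+n_1+n_2+1}}\,\frac{(1-p)^{t_1-2n_1-x_1}}{(1+pz)^{t_1+t_2+1-(x_1+n_1+n_2)}},$$ $$\phi^{((n_1,t_1),(n_2,t_2))}(x_1,x_2)=\frac{1}{2\pi \mathrm{i}}\oint_{\Gamma_{-1}}dw\,\frac{(1+pw)^{t_1-t_2}}{(1+w)^{x_1-x_2+1}}\left(\frac{-w}{(1+w)(1+pw)}\right)^{n_1-n_2}.$$ Here $\Gamma_0$ (resp. $\Gamma_{-1}$) is any piecewise $C^1$ simple loop, anticlockwise oriented, which passes through no pole of the integrand, encloses $0$ (resp. $-1$), and encloses no other pole of the integrand. The Fredholm determinant is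 given by its Fredholm series $$\det(\mathbb{1}-L)_{\ell^2(X)}=\sum_{n\ge 0}\frac{(-1)^n}{n!}\sum_{(y_1,\ldots,y_n)\in X^n}\det\big(L(y_i,y_j)\big)_{1\le i,j\le n},$$ and it is part of the claim that, for $L=\chi K\chi$, this series converges absolutely (as a sum over all $n$ and all $(y_1,\ldots,y_n)\in X^n$). -/

import Mathlib

open MeasureTheory ProbabilityTheory

noncomputable section

/-! ### Discrete-time TASEP with parallel update -/

/-- `x i t` is the position at time `t` of the particle with label `i`, in the discrete-time TASEP
with parallel update, hop probability `p` and deterministic initial positions `y`.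
The variable `ξ (i, t)` is the coin which particle `i` flips for its attempt to hop between the
times `t` and `t + 1`; all coins are independent. All particles are updated simultaneously:
particle `i` moves one step to the right if its coin shows `true` and if the site on its right is
empty at time `t`, and it stays where it is otherwise. -/
def IsParallelTASEP {Ω : Type*} [MeasurableSpace Ω] (P : Measure Ω) (p : ℝ) (y : ℤ → ℤ)
    (x : ℤ → ℕ → Ω → ℤ) : Prop :=
  ∃ ξ : ℤ × ℕ → Ω → Bool,
    (∀ e, Measurable (ξ e)) ∧ iIndepFun ξ P ∧ (∀ e, P.real {ω | ξ e ω = true} = p) ∧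
    ∀ᵐ ω ∂P, (∀ i, x i 0 ω = y i) ∧
      ∀ i t,
        ((ξ (i, t) ω = true ∧ ∀ j, x j t ω ≠ x i t ω + 1) → x i (t + 1) ω = x i t ω + 1) ∧
        (¬ (ξ (i, t) ω = true ∧ ∀ j, x j t ω ≠ x i t ω + 1) → x i (t + 1) ω = x i t ω)

/-- The partial order `(n, t) ≺ (n', t')` on pairs (particle label, time). -/
def SpaceLikePrec (c c' : ℤ × ℕ) : Prop :=
  c.1 ≤ c'.1 ∧ c'.2 ≤ c.2 ∧ c ≠ c'

/-! ### Contour integrals -/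

/-- The contour integral of `f` along the curve `γ`, parametrized by `[0, 1]`. -/
def loopIntegral (f : ℂ → ℂ) (γ : ℝ → ℂ) : ℂ :=
  ∫ s in (0 : ℝ)..1, f (γ s) * deriv γ s

/-- The winding number of the closed curve `γ` around the point `a`. -/
def windingNumber (γ : ℝ → ℂ) (a : ℂ) : ℂ :=
  (2 * Real.pi * Complex.I)⁻¹ * loopIntegral (fun z => (z - a)⁻¹) γ

/-- The restriction of `γ` to `[0, 1]` is a (piecewise continuously differentiable, rectifiable)
simple loop. -/
structure IsSimpleLoop (γ : ℝ → ℂ) : Prop where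
  continuousOn : ContinuousOn γ (Set.Icc 0 1)
  closed : γ 0 = γ 1
  simple : Set.InjOn γ (Set.Ico 0 1)
  piecewise_C1 : ∃ s : Set ℝ, s.Finite ∧
    ∀ t ∈ Set.Ioo (0 : ℝ) 1 \ s, DifferentiableAt ℝ γ t ∧ ContinuousAt (deriv γ) t
  rectifiable : IntervalIntegrable (deriv γ) volume 0 1

/-- `z` is a pole of the meromorphic function `f`. -/
def IsPole (f : ℂ → ℂ) (z : ℂ) : Prop := meromorphicOrderAt f z < 0

/-- `γ` is a simple loop, anticlockwise oriented, which passes neither through `a` nor through a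
pole of `f`, which encloses `a`, and which encloses no pole of `f` other than `a`.
(An anticlockwise simple loop has winding number `1` around the points inside of it and `0` around
the points outside of it.) -/
structure IsContourAround (f : ℂ → ℂ) (a : ℂ) (γ : ℝ → ℂ) : Prop where
  isSimpleLoop : IsSimpleLoop γ
  avoids_center : ∀ s ∈ Set.Icc (0 : ℝ) 1, γ s ≠ a
  avoids_poles : ∀ s ∈ Set.Icc (0 : ℝ) 1, ¬ IsPole f (γ s)
  encloses_center : windingNumber γ a = 1
  excludes_poles : ∀ z, z ≠ a → IsPole f z → windingNumber γ z = 0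

/-! ### The extended kernel

A point `((n, t), x)` consists of a particle label, a time and a position. -/

/-- The integrand of the contour integral which defines `phiTASEP`. -/
def phiIntegrand (p : ℝ) : (ℤ × ℕ) × ℤ → (ℤ × ℕ) × ℤ → ℂ → ℂ
  | ((n₁, t₁), x₁), ((n₂, t₂), x₂) => fun w =>
    (1 + p * w) ^ ((t₁ : ℤ) - (t₂ : ℤ)) / (1 + w) ^ (x₁ - x₂ + 1) *
      (-w / ((1 + w) * (1 + p * w))) ^ (n₁ - n₂)

/-- The integrand of the contour integral which defines `kTildeTASEP`. -/
def kTildeIntegrand (p : ℝ) : (ℤ × ℕ) × ℤ → (ℤ × ℕ) × ℤ → ℂ → ℂ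
  | ((n₁, t₁), x₁), ((n₂, t₂), x₂) => fun z =>
    (1 + z) ^ (x₂ + n₁ + n₂) / (-z) ^ (x₁ + n₁ + n₂ + 1) *
      ((1 - (p : ℂ)) ^ ((t₁ : ℤ) - 2 * n₁ - x₁) /
        (1 + p * z) ^ ((t₁ : ℤ) + (t₂ : ℤ) + 1 - (x₁ + n₁ + n₂)))

/-- The function `φ`, computed along the loop `γ` around `-1`. -/
def phiTASEP (p : ℝ) (γ : ℝ → ℂ) (u v : (ℤ × ℕ) × ℤ) : ℂ :=
  1 / (2 * Real.pi * Complex.I) * loopIntegral (phiIntegrand p u v) γ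

/-- The function `K̃`, computed along the loop `γ` around `0`. -/
def kTildeTASEP (p : ℝ) (γ : ℝ → ℂ) (u v : (ℤ × ℕ) × ℤ) : ℂ :=
  -1 / (2 * Real.pi * Complex.I) * loopIntegral (kTildeIntegrand p u v) γ

open Classical in
/-- The extended kernel `K`. The loops `Γ₁` (around `-1`, for `φ`) and `Γ₀` (around `0`, for `K̃`)
may be different for different entries of the kernel. -/
def kernelTASEP (p : ℝ) (Γ₁ Γ₀ : (ℤ × ℕ) × ℤ → (ℤ × ℕ) × ℤ → ℝ → ℂ)
    (u v : (ℤ × ℕ) × ℤ) : ℂ :=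
  -(if SpaceLikePrec u.1 v.1 then phiTASEP p (Γ₁ u v) u v else 0) + kTildeTASEP p (Γ₀ u v) u v

/-! ### Fredholm determinants on a discrete space -/

/-- `d` is the Fredholm determinant `det(1 - K)` on `ℓ²(X)` (with counting measure on `X`): the
Fredholm series `∑ₙ (-1)ⁿ/n! ∑_{y ∈ Xⁿ} det (K(yᵢ, yⱼ))_{1 ≤ i, j ≤ n}` converges absolutely, as a
sum over all `n` and all `y ∈ Xⁿ`, and its sum is `d`. -/
def HasFredholmDet {X : Type*} (K : X → X → ℂ) (d : ℂ) : Prop :=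
  HasSum (fun y : Σ n : ℕ, (Fin n → X) =>
    (-1 : ℂ) ^ y.1 / (y.1.factorial : ℂ) *
      Matrix.det (Matrix.of fun i j : Fin y.1 => K (y.2 i) (y.2 j))) d

/-- The cut-off `χ` : the indicator function of `x < a_k` on `{1, …, m} × ℤ`. -/
def chiBelow {m : ℕ} (a : Fin m → ℤ) (u : Fin m × ℤ) : ℂ :=
  if u.2 < a u.1 then 1 else 0

end

/-! Both sides obey the same recursion, which ends at time `0`.

For the process, condition on one coin. Particle `n` is at `b` or beyond at time `t + 1` iff it
already was at time `t`, or it stood at `b - 1`, its coin shows `true` and particle `n - 1` was at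
`b + 1` or beyond. If every other constraint has label below `n` and time `t + 1`, or label at least
`n` and time at most `t`, then the coin is independent of them. The probability with `x_n(t+1) ≥ b`
is then `1 - p` times the one with `x_n(t) ≥ b`, plus `p` times the one with `x_{n-1}(t) ≥ b + 1`
and `x_n(t) ≥ b - 1` (`measureReal_flip`). In a space-like chain, the point of largest label among
those of maximal time admits this step.

For the determinant, `1 - K` has zero rows far to the left, so the Fredholm determinant is a finite
one, `gapDet`. All entries are residues of `z ^ i * (1 + z) ^ j * (1 + p * z) ^ k`. Linear
identities between `1`, `z`, `1 + z` and `1 + p z` become linear relations between rows, or between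
columns, of `1 - K`; a unit vector appears where `φ` is switched on or off. These relations make
most rows redundant, so the three determinants of the recursion become one common block bordered by
a single point each, and two row relations and one column relation give the recursion
(`minorDet_flip`, `gapDet_flip`). At time `0` either the matrix is block triangular with unit
diagonal, or a column vanishes because of the flat initial condition.

The same linear relations, read as partial fractions, show that the contour integrals depend only on
winding numbers around the poles (`eq_zero_of_ratFun_relations`). -/

noncomputable section

/-! ### Residues of `z ^ i * (1 + z) ^ j * (1 + p * z) ^ k` at `0` and `-1` -/

/-- The rational function `z ^ i * (1 + z) ^ j * (1 + p * z) ^ k`. -/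
def ratFun (p : ℝ) (i j k : ℤ) (z : ℂ) : ℂ := z ^ i * (1 + z) ^ j * (1 + p * z) ^ k

theorem ratFun_succ_j {p : ℝ} {i j k : ℤ} {z : ℂ} (hi : i < 0 → z ≠ 0) (hj : j < 0 → 1 + z ≠ 0) :
    ratFun p i (j + 1) k z = ratFun p (i + 1) j k z + ratFun p i j k z := by
  have h1 : (1 + z) ^ (j + 1) = (1 + z) ^ j * (1 + z) := by
    rcases lt_or_ge j 0 with h | h
    · exact zpow_add_one₀ (hj h) j
    · lift j to ℕ using h
      exact_mod_cast pow_succ (1 + z) j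
  have h2 : z ^ (i + 1) = z ^ i * z := by
    rcases lt_or_ge i 0 with h | h
    · exact zpow_add_one₀ (hi h) i
    · lift i to ℕ using h
      exact_mod_cast pow_succ z i
  simp only [ratFun, h1, h2]
  ring

theorem ratFun_succ_k {p : ℝ} {i j k : ℤ} {z : ℂ} (hi : i < 0 → z ≠ 0)
    (hk : k < 0 → 1 + (p : ℂ) * z ≠ 0) :
    ratFun p i j (k + 1) z = p * ratFun p (i + 1) j k z + ratFun p i j k z := by
  have h1 : (1 + (p : ℂ) * z) ^ (k + 1) = (1 + (p : ℂ) * z) ^ k * (1 + (p : ℂ) * z) := by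
    rcases lt_or_ge k 0 with h | h
    · exact zpow_add_one₀ (hk h) k
    · lift k to ℕ using h
      exact_mod_cast pow_succ (1 + (p : ℂ) * z) k
  have h2 : z ^ (i + 1) = z ^ i * z := by
    rcases lt_or_ge i 0 with h | h
    · exact zpow_add_one₀ (hi h) i
    · lift i to ℕ using h
      exact_mod_cast pow_succ z i
  simp only [ratFun, h1, h2]
  ring

theorem continuousAt_ratFun {p : ℝ} {i j k : ℤ} {z : ℂ} (hi : i < 0 → z ≠ 0)
    (hj : j < 0 → 1 + z ≠ 0) (hk : k < 0 → 1 + (p : ℂ) * z ≠ 0) :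
    ContinuousAt (ratFun p i j k) z := by
  have cond : ∀ {n : ℤ} {x : ℂ}, (n < 0 → x ≠ 0) → x ≠ 0 ∨ 0 ≤ n := fun {n x} h => by
    rcases lt_or_ge n 0 with h' | h'
    · exact Or.inl (h h')
    · exact Or.inr h'
  exact ((continuousAt_id.zpow₀ i (cond hi)).mul
    ((continuousAt_const.add continuousAt_id).zpow₀ j (cond hj))).mul
    ((continuousAt_const.add (continuousAt_const.mul continuousAt_id)).zpow₀ k (cond hk))

theorem differentiableAt_ratFun {p : ℝ} {i j k : ℤ} {z : ℂ} (hi : i < 0 → z ≠ 0)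
    (hj : j < 0 → 1 + z ≠ 0) (hk : k < 0 → 1 + (p : ℂ) * z ≠ 0) :
    DifferentiableAt ℂ (ratFun p i j k) z := by
  have cond : ∀ {n : ℤ} {x : ℂ}, (n < 0 → x ≠ 0) → x ≠ 0 ∨ 0 ≤ n := fun {n x} h => by
    rcases lt_or_ge n 0 with h' | h'
    · exact Or.inl (h h')
    · exact Or.inr h'
  exact ((differentiableAt_id.zpow (cond hi)).mul
    (((differentiableAt_const 1).add differentiableAt_id).zpow (cond hj))).mul
    (((differentiableAt_const 1).add ((differentiableAt_const _).mul differentiableAt_id)).zpow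
      (cond hk))

/-- The normalized integral of `ratFun` along the circle of radius `(1 - p) / 2` around `a`. -/
def circleRes (p : ℝ) (a : ℂ) (i j k : ℤ) : ℂ :=
  (2 * Real.pi * Complex.I)⁻¹ * ∮ z in C(a, (1 - p) / 2), ratFun p i j k z

section
variable {p : ℝ} (hp0 : 0 < p) (hp1 : p < 1)

theorem one_add_ne_zero_of_norm {z : ℂ} (h : ‖z‖ < 1) : 1 + z ≠ 0 := by
  intro h0
  have : z = -1 := by linear_combination h0
  rw [this] at h
  simp at h

include hp0 hp1

/-- The radius `(1 - p) / 2` is smaller than the distance `1` from `0` to `-1` and the distance `(1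
- p) / p` from `-1` to `-1/p`, so each circle isolates its centre among `0`, `-1`, `-1/p`. -/
theorem disc_zero_ne {z : ℂ} (hz : ‖z‖ ≤ (1 - p) / 2) :
    1 + z ≠ 0 ∧ 1 + (p : ℂ) * z ≠ 0 := by
  refine ⟨one_add_ne_zero_of_norm (by linarith), one_add_ne_zero_of_norm ?_⟩
  rw [norm_mul, Complex.norm_real, Real.norm_of_nonneg hp0.le]
  nlinarith [norm_nonneg z]

theorem disc_neg_one_ne {z : ℂ} (hz : ‖z + 1‖ ≤ (1 - p) / 2) :
    z ≠ 0 ∧ 1 + (p : ℂ) * z ≠ 0 := by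
  constructor
  · rintro rfl
    simp at hz
    linarith
  · intro h
    have h1 : (p : ℂ) * (z + 1) = -((1 - p : ℝ) : ℂ) := by
      push_cast
      linear_combination h
    have h2 := congrArg norm h1
    rw [norm_mul, norm_neg, Complex.norm_real, Complex.norm_real, Real.norm_of_nonneg hp0.le,
      Real.norm_of_nonneg (by linarith)] at h2
    nlinarith [norm_nonneg (z + 1)]

theorem sphere_zero_ne {z : ℂ} (hz : z ∈ Metric.sphere (0 : ℂ) ((1 - p) / 2)) :
    z ≠ 0 ∧ 1 + z ≠ 0 ∧ 1 + (p : ℂ) * z ≠ 0 := by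
  have h : ‖z‖ = (1 - p) / 2 := by simpa using hz
  refine ⟨?_, disc_zero_ne hp0 hp1 h.le⟩
  rintro rfl
  simp at h
  linarith

theorem sphere_neg_one_ne {z : ℂ} (hz : z ∈ Metric.sphere (-1 : ℂ) ((1 - p) / 2)) :
    z ≠ 0 ∧ 1 + z ≠ 0 ∧ 1 + (p : ℂ) * z ≠ 0 := by
  have h : ‖z + 1‖ = (1 - p) / 2 := by
    simpa [dist_eq_norm] using hz
  refine ⟨(disc_neg_one_ne hp0 hp1 h.le).1, ?_, (disc_neg_one_ne hp0 hp1 h.le).2⟩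
  intro h0
  rw [add_comm] at h0
  rw [h0] at h
  simp at h
  linarith

theorem sphere_ne {a z : ℂ} (ha : a = 0 ∨ a = -1) (hz : z ∈ Metric.sphere a ((1 - p) / 2)) :
    z ≠ 0 ∧ 1 + z ≠ 0 ∧ 1 + (p : ℂ) * z ≠ 0 := by
  rcases ha with rfl | rfl
  · exact sphere_zero_ne hp0 hp1 hz
  · exact sphere_neg_one_ne hp0 hp1 hz

theorem circleIntegrable_ratFun {a : ℂ} (ha : a = 0 ∨ a = -1) (i j k : ℤ) :
    CircleIntegrable (ratFun p i j k) a ((1 - p) / 2) := by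
  refine ContinuousOn.circleIntegrable (by linarith) fun z hz => ?_
  obtain ⟨h1, h2, h3⟩ := sphere_ne hp0 hp1 ha hz
  exact (continuousAt_ratFun (fun _ => h1) (fun _ => h2) (fun _ => h3)).continuousWithinAt

theorem circleRes_succ_j {a : ℂ} (ha : a = 0 ∨ a = -1) (i j k : ℤ) :
    circleRes p a i (j + 1) k = circleRes p a (i + 1) j k + circleRes p a i j k := by
  simp only [circleRes]
  rw [← mul_add, ← circleIntegral.integral_add (circleIntegrable_ratFun hp0 hp1 ha _ _ _)
    (circleIntegrable_ratFun hp0 hp1 ha _ _ _)]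
  congr 1
  refine circleIntegral.integral_congr (by linarith) fun z hz => ?_
  obtain ⟨h1, h2, h3⟩ := sphere_ne hp0 hp1 ha hz
  exact ratFun_succ_j (fun _ => h1) (fun _ => h2)

theorem circleRes_succ_k {a : ℂ} (ha : a = 0 ∨ a = -1) (i j k : ℤ) :
    circleRes p a i j (k + 1) = p * circleRes p a (i + 1) j k + circleRes p a i j k := by
  have : ∀ z ∈ Metric.sphere a ((1 - p) / 2),
      ratFun p i j (k + 1) z = (p : ℂ) • ratFun p (i + 1) j k z + ratFun p i j k z := by
    intro z hz
    obtain ⟨h1, h2, h3⟩ := sphere_ne hp0 hp1 ha hz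
    exact ratFun_succ_k (fun _ => h1) (fun _ => h3)
  simp only [circleRes]
  have hi : CircleIntegrable (fun z => (p : ℂ) • ratFun p (i + 1) j k z) a ((1 - p) / 2) :=
    (circleIntegrable_ratFun hp0 hp1 ha _ _ _).const_smul
  rw [circleIntegral.integral_congr (by linarith) this,
    circleIntegral.integral_add hi (circleIntegrable_ratFun hp0 hp1 ha _ _ _),
    circleIntegral.integral_smul, smul_eq_mul]
  ring

theorem circleRes_zero_of_nonneg {i : ℤ} (hi : 0 ≤ i) (j k : ℤ) : circleRes p 0 i j k = 0 := by
  have hd : ∀ z ∈ Metric.closedBall (0 : ℂ) ((1 - p) / 2),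
      DifferentiableAt ℂ (ratFun p i j k) z := fun z hz => by
    obtain ⟨h2, h3⟩ := disc_zero_ne hp0 hp1 (z := z) (by simpa using hz)
    exact differentiableAt_ratFun (fun h => absurd hi (by omega)) (fun _ => h2) (fun _ => h3)
  rw [circleRes, Complex.circleIntegral_eq_zero_of_differentiable_on_off_countable (by linarith)
    Set.countable_empty (fun z hz => (hd z hz).continuousAt.continuousWithinAt)
    (fun z hz => hd z (Metric.ball_subset_closedBall hz.1)), mul_zero]

theorem circleRes_neg_one_of_nonneg {j : ℤ} (hj : 0 ≤ j) (i k : ℤ) :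
    circleRes p (-1) i j k = 0 := by
  have hd : ∀ z ∈ Metric.closedBall (-1 : ℂ) ((1 - p) / 2),
      DifferentiableAt ℂ (ratFun p i j k) z := fun z hz => by
    obtain ⟨h2, h3⟩ := disc_neg_one_ne hp0 hp1 (z := z) (by simpa [dist_eq_norm] using hz)
    exact differentiableAt_ratFun (fun _ => h2) (fun h => absurd hj (by omega)) (fun _ => h3)
  rw [circleRes, Complex.circleIntegral_eq_zero_of_differentiable_on_off_countable (by linarith)
    Set.countable_empty (fun z hz => (hd z hz).continuousAt.continuousWithinAt)
    (fun z hz => hd z (Metric.ball_subset_closedBall hz.1)), mul_zero]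

omit hp0 in
theorem circleIntegral_sub_zpow (a : ℂ) (n : ℤ) :
    (2 * Real.pi * Complex.I)⁻¹ * (∮ z in C(a, (1 - p) / 2), (z - a) ^ n) =
      if n = -1 then 1 else 0 := by
  split_ifs with h
  · subst h
    simp only [zpow_neg_one]
    rw [circleIntegral.integral_sub_center_inv _ (by linarith)]
    exact inv_mul_cancel₀ Complex.two_pi_I_ne_zero
  · rw [circleIntegral.integral_sub_zpow_of_ne h, mul_zero]

omit hp0 in
theorem circleRes_zero_pow (i : ℤ) : circleRes p 0 i 0 0 = if i = -1 then 1 else 0 := by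
  rw [← circleIntegral_sub_zpow hp1 0 i]
  simp [circleRes, ratFun]

omit hp0 in
theorem circleRes_neg_one_pow (j : ℤ) : circleRes p (-1) 0 j 0 = if j = -1 then 1 else 0 := by
  rw [← circleIntegral_sub_zpow hp1 (-1) j]
  simp [circleRes, ratFun, add_comm]

theorem circleRes_zero_neg_one : circleRes p 0 (-1) 0 (-1) = 1 := by
  have h := circleRes_succ_k hp0 hp1 (Or.inl rfl) (-1) 0 (-1)
  norm_num at h
  rw [circleRes_zero_of_nonneg hp0 hp1 le_rfl, circleRes_zero_pow hp1] at h
  simpa using h.symm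

/-- The residue is the coefficient of degree `-1 - i > m` of the polynomial `(1 + p z) ^ m`. -/
theorem circleRes_zero_of_degree (m : ℕ) :
    ∀ i : ℤ, i + m ≤ -2 → circleRes p 0 i 0 m = 0 := by
  induction m with
  | zero =>
    intro i hi
    have := circleRes_zero_pow hp1 i
    rw [if_neg (by push_cast at hi; omega)] at this
    simpa using this
  | succ m ih =>
    intro i hi
    push_cast at hi ⊢
    rw [circleRes_succ_k hp0 hp1 (Or.inl rfl), ih _ (by omega), ih _ (by omega)]
    simp

end

/-! ### Recurrences for `φ` and `K̃` in label, time and position -/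

/-- The value of `phiTASEP` in terms of the differences of label, position and time. -/
def phiCoeff (p : ℝ) (d s τ : ℤ) : ℂ :=
  (-1) ^ d * circleRes p (-1) (-d) (d - s - 1) (τ + d)

/-- The value of `kTildeTASEP`, with `r = x₁ + n₁ + n₂`, `j = x₂ + n₁ + n₂`, `q = t₁ + t₂` and
`e = t₁ - 2 * n₁ - x₁`. -/
def kCoeff (p : ℝ) (r j q e : ℤ) : ℂ :=
  (-1) ^ r * (1 - (p : ℂ)) ^ e * circleRes p 0 (-r - 1) j (r - q - 1)

section
variable {p : ℝ} (hp0 : 0 < p) (hp1 : p < 1)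

theorem neg_one_zpow_add_one (n : ℤ) : (-1 : ℂ) ^ (n + 1) = -(-1) ^ n := by
  rw [zpow_add_one₀ (by norm_num)]
  ring

include hp1 in
theorem one_sub_ofReal_ne_zero : (1 - (p : ℂ)) ≠ 0 := by
  rw [sub_ne_zero]
  exact_mod_cast hp1.ne'

include hp0 hp1

theorem phiCoeff_eq_zero {d s : ℤ} (h : s < d) (τ : ℤ) : phiCoeff p d s τ = 0 := by
  rw [phiCoeff, circleRes_neg_one_of_nonneg hp0 hp1 (by omega), mul_zero]

omit hp0 in
theorem phiCoeff_zero (s : ℤ) : phiCoeff p 0 s 0 = if s = 0 then 1 else 0 := by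
  have := circleRes_neg_one_pow hp1 (-s - 1)
  simp only [phiCoeff, zpow_zero, neg_zero, zero_sub, add_zero, one_mul, this]
  exact if_congr (by omega) rfl rfl

/-- The additional factor is `1 + p w = (1 - p) + p (1 + w)`. -/
theorem phiCoeff_time (d s τ : ℤ) :
    phiCoeff p d s (τ + 1) = (1 - p) * phiCoeff p d s τ + p * phiCoeff p d (s - 1) τ := by
  simp only [phiCoeff]
  rw [show d - (s - 1) - 1 = d - s - 1 + 1 by ring, show τ + 1 + d = τ + d + 1 by ring,
    circleRes_succ_k hp0 hp1 (Or.inr rfl), circleRes_succ_j hp0 hp1 (Or.inr rfl)]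
  ring

/-- The difference in `s` brings out `1 - (1 + w) = -w`, which cancels one factor of the label
power; what remains is the factor `1 + p w = (1 - p) + p (1 + w)`. -/
theorem phiCoeff_label (d s τ : ℤ) :
    phiCoeff p (d + 1) s τ - phiCoeff p (d + 1) (s - 1) τ =
      (1 - p) * phiCoeff p d (s - 1) τ + p * phiCoeff p d (s - 2) τ := by
  simp only [phiCoeff, neg_one_zpow_add_one]
  have h1 := circleRes_succ_j hp0 hp1 (Or.inr rfl) (-(d + 1)) (d - s) (τ + d + 1)
  have h2 := circleRes_succ_k hp0 hp1 (Or.inr rfl) (-d) (d - s) (τ + d)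
  have h3 := circleRes_succ_j hp0 hp1 (Or.inr rfl) (-d) (d - s) (τ + d)
  rw [show d + 1 - s - 1 = d - s by ring, show d + 1 - (s - 1) - 1 = d - s + 1 by ring,
    show τ + (d + 1) = τ + d + 1 by ring, show d - (s - 1) - 1 = d - s by ring,
    show d - (s - 2) - 1 = d - s + 1 by ring]
  rw [show -(d + 1) + 1 = -d by ring] at h1
  linear_combination (-1 : ℂ) ^ d * h1 + (-1 : ℂ) ^ d * h2 - (-1 : ℂ) ^ d * p * h3

/-- Here `1 + p w` is split as `1 + p * w`, and the factor `w` lowers the label difference. -/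
theorem phiCoeff_flip (d s τ : ℤ) :
    phiCoeff p d s (τ - 1) = phiCoeff p d s τ + p * phiCoeff p (d - 1) (s - 1) τ := by
  have hs : (-1 : ℂ) ^ d = -(-1) ^ (d - 1) := by
    rw [← neg_one_zpow_add_one, sub_add_cancel]
  simp only [phiCoeff, hs]
  have h2 := circleRes_succ_k hp0 hp1 (Or.inr rfl) (-d) (d - s - 1) (τ + d - 1)
  rw [show d - 1 - (s - 1) - 1 = d - s - 1 by ring, show τ + (d - 1) = τ + d - 1 by ring,
    show -(d - 1) = -d + 1 by ring, show τ - 1 + d = τ + d - 1 by ring]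
  rw [sub_add_cancel] at h2
  linear_combination (-1 : ℂ) ^ (d - 1) * h2

theorem kCoeff_eq_zero {r : ℤ} (h : r < 0) (j q e : ℤ) : kCoeff p r j q e = 0 := by
  rw [kCoeff, circleRes_zero_of_nonneg hp0 hp1 (by omega), mul_zero]

/-- The integrand is `z ^ (-r - 1) * (1 + p z) ^ (r - 1)`: regular for `r < 0`, with a simple pole
for `r = 0`, and for `r > 0` the residue asks for degree `r` in a polynomial of degree `r - 1`. -/
theorem kCoeff_flat (r : ℤ) : kCoeff p r 0 0 (-r) = if r = 0 then 1 else 0 := by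
  rcases lt_trichotomy r 0 with h | h | h
  · rw [kCoeff_eq_zero hp0 hp1 h, if_neg h.ne]
  · subst h
    have := circleRes_zero_neg_one hp0 hp1
    simp [kCoeff, this]
  · have := circleRes_zero_of_degree hp0 hp1 (r - 1).toNat (-r - 1) (by omega)
    rw [Int.toNat_of_nonneg (by omega)] at this
    rw [kCoeff, if_neg h.ne', sub_zero, this, mul_zero]

theorem kCoeff_time_left (r j q e : ℤ) :
    kCoeff p r j (q + 1) (e + 1) =
      (1 - p) * kCoeff p r j q e + p * kCoeff p (r - 1) j q (e + 1) := by
  have hs : (-1 : ℂ) ^ r = -(-1) ^ (r - 1) := by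
    rw [← neg_one_zpow_add_one, sub_add_cancel]
  have h2 := circleRes_succ_k hp0 hp1 (Or.inl rfl) (-r - 1) j (r - q - 2)
  simp only [kCoeff, hs, zpow_add_one₀ (one_sub_ofReal_ne_zero hp1)]
  rw [show r - (q + 1) - 1 = r - q - 2 by ring, show -(r - 1) - 1 = -r by ring,
    show r - 1 - q - 1 = r - q - 2 by ring]
  rw [show r - q - 2 + 1 = r - q - 1 by ring, show -r - 1 + 1 = -r by ring] at h2
  linear_combination (-1 : ℂ) ^ (r - 1) * (1 - (p : ℂ)) ^ e * (1 - p) * h2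

/-- After common factors are removed, the left side is `(1 + p z) + (1 - p) z = 1 + z`, and the
right side is `(1 + z) * ((1 + p z) - p z)`. -/
theorem kCoeff_label_left (r j q e : ℤ) :
    kCoeff p r j q (e + 1) - kCoeff p (r - 1) j q (e + 2) =
      (1 - p) * kCoeff p r (j + 1) q e + p * kCoeff p (r - 1) (j + 1) q (e + 1) := by
  have hs : (-1 : ℂ) ^ r = -(-1) ^ (r - 1) := by
    rw [← neg_one_zpow_add_one, sub_add_cancel]
  have h1 := circleRes_succ_k hp0 hp1 (Or.inl rfl) (-r - 1) j (r - q - 2)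
  have h2 := circleRes_succ_k hp0 hp1 (Or.inl rfl) (-r - 1) (j + 1) (r - q - 2)
  have h3 := circleRes_succ_j hp0 hp1 (Or.inl rfl) (-r - 1) j (r - q - 2)
  simp only [kCoeff, hs, zpow_add_one₀ (one_sub_ofReal_ne_zero hp1),
    show e + 2 = e + 1 + 1 by ring]
  rw [show -(r - 1) - 1 = -r by ring, show r - 1 - q - 1 = r - q - 2 by ring]
  rw [show r - q - 2 + 1 = r - q - 1 by ring, show -r - 1 + 1 = -r by ring] at h1 h2
  rw [show -r - 1 + 1 = -r by ring] at h3
  linear_combination (-1 : ℂ) ^ (r - 1) * (1 - (p : ℂ)) ^ e * (1 - p) * (-h1 + h2 + h3)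

theorem kCoeff_time_right (r j q e : ℤ) :
    kCoeff p r j q e = (1 - p) * kCoeff p r j (q + 1) e + p * kCoeff p r (j + 1) (q + 1) e := by
  simp only [kCoeff]
  have h2 := circleRes_succ_k hp0 hp1 (Or.inl rfl) (-r - 1) j (r - q - 2)
  have h3 := circleRes_succ_j hp0 hp1 (Or.inl rfl) (-r - 1) j (r - q - 2)
  rw [show r - (q + 1) - 1 = r - q - 2 by ring]
  rw [show r - q - 2 + 1 = r - q - 1 by ring] at h2
  linear_combination (-1 : ℂ) ^ r * (1 - (p : ℂ)) ^ e * (h2 - p * h3)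

theorem kCoeff_flip (r j q e : ℤ) :
    kCoeff p r j (q + 1) e = kCoeff p r j q e + p * kCoeff p (r - 1) j q e := by
  have hs : (-1 : ℂ) ^ r = -(-1) ^ (r - 1) := by
    rw [← neg_one_zpow_add_one, sub_add_cancel]
  have h2 := circleRes_succ_k hp0 hp1 (Or.inl rfl) (-r - 1) j (r - q - 2)
  simp only [kCoeff, hs]
  rw [show -(r - 1) - 1 = -r by ring, show r - 1 - q - 1 = r - q - 2 by ring,
    show r - (q + 1) - 1 = r - q - 2 by ring]
  rw [show r - q - 2 + 1 = r - q - 1 by ring, show -r - 1 + 1 = -r by ring] at h2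
  linear_combination (-1 : ℂ) ^ (r - 1) * (1 - (p : ℂ)) ^ e * h2

end

/-! ### Linear relations between rows and columns of `1 - K` -/

/-- The reflexive closure of `SpaceLikePrec`. -/
def SpaceLikeLE (c c' : ℤ × ℕ) : Prop := c.1 ≤ c'.1 ∧ c'.2 ≤ c.2

instance (c c' : ℤ × ℕ) : Decidable (SpaceLikeLE c c') :=
  inferInstanceAs (Decidable (c.1 ≤ c'.1 ∧ c'.2 ≤ c.2))

/-- The value of `phiTASEP` along any contour. -/
def phiRes (p : ℝ) (u v : (ℤ × ℕ) × ℤ) : ℂ :=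
  phiCoeff p (v.1.1 - u.1.1) (u.2 - v.2) (u.1.2 - v.1.2)

/-- The value of `kTildeTASEP` along any contour. -/
def kRes (p : ℝ) (u v : (ℤ × ℕ) × ℤ) : ℂ :=
  kCoeff p (u.2 + u.1.1 + v.1.1) (v.2 + u.1.1 + v.1.1) (u.1.2 + v.1.2) (u.1.2 - 2 * u.1.1 - u.2)

/-- The kernel `1 - K`. -/
def complKernel (p : ℝ) (u v : (ℤ × ℕ) × ℤ) : ℂ :=
  (if SpaceLikeLE u.1 v.1 then phiRes p u v else 0) - kRes p u v

section
variable {p : ℝ} (hp0 : 0 < p) (hp1 : p < 1)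

include hp1 in
theorem phiRes_self (c : ℤ × ℕ) (x y : ℤ) :
    phiRes p (c, x) (c, y) = if x = y then 1 else 0 := by
  simp [phiRes, phiCoeff_zero hp1, sub_eq_zero]

include hp0 hp1

theorem phiRes_eq_zero {u v : (ℤ × ℕ) × ℤ} (h : u.2 + u.1.1 < v.2 + v.1.1) :
    phiRes p u v = 0 := phiCoeff_eq_zero hp0 hp1 (by omega) _

theorem kRes_eq_zero {u v : (ℤ × ℕ) × ℤ} (h : u.2 + u.1.1 + v.1.1 < 0) : kRes p u v = 0 :=
  kCoeff_eq_zero hp0 hp1 h _ _ _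

theorem kRes_flat (n x : ℤ) :
    kRes p ((n, 0), x) ((n, 0), -2 * n) = if x = -2 * n then 1 else 0 := by
  have h := kCoeff_flat hp0 hp1 (x + n + n)
  simp only [kRes]
  convert h using 2
  · ring
  · simp only [Nat.cast_zero]
    ring
  · omega
  · omega

/-- `φ` vanishes since `x + n` is smaller for `u` than for `v`, and `K̃` since `x + n` plus the
label of `v` is below `-N + N`. This makes the truncation to a finite window exact. -/
theorem complKernel_eq_zero_of_low {N : ℤ} {u v : (ℤ × ℕ) × ℤ} (hv : v.1.1 ≤ N)
    (hv' : -N ≤ v.2 + v.1.1) (hu : u.2 + u.1.1 < -N) : complKernel p u v = 0 := by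
  rw [complKernel, kRes_eq_zero hp0 hp1 (by omega), phiRes_eq_zero hp0 hp1 (by omega)]
  simp

omit hp0 in
theorem complKernel_self (c : ℤ × ℕ) (x y : ℤ) :
    complKernel p (c, x) (c, y) = (if x = y then 1 else 0) - kRes p (c, x) (c, y) := by
  rw [complKernel, if_pos ⟨le_rfl, le_rfl⟩, phiRes_self hp1]

theorem kRes_time_left (n : ℤ) (t : ℕ) (x : ℤ) (v : (ℤ × ℕ) × ℤ) :
    kRes p ((n, t + 1), x) v =
      (1 - p) * kRes p ((n, t), x) v + p * kRes p ((n, t), x - 1) v := by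
  have h := kCoeff_time_left hp0 hp1 (x + n + v.1.1) (v.2 + n + v.1.1) (t + v.1.2) (t - 2 * n - x)
  simp only [kRes]
  push_cast
  ring_nf at h ⊢
  linear_combination h

theorem phiRes_time_left (n : ℤ) (t : ℕ) (x : ℤ) (v : (ℤ × ℕ) × ℤ) :
    phiRes p ((n, t + 1), x) v =
      (1 - p) * phiRes p ((n, t), x) v + p * phiRes p ((n, t), x - 1) v := by
  have h := phiCoeff_time hp0 hp1 (v.1.1 - n) (x - v.2) (t - v.1.2)
  simp only [phiRes]
  push_cast
  ring_nf at h ⊢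
  linear_combination h

theorem kRes_time_right (u : (ℤ × ℕ) × ℤ) (n : ℤ) (t : ℕ) (y : ℤ) :
    kRes p u ((n, t), y) =
      (1 - p) * kRes p u ((n, t + 1), y) + p * kRes p u ((n, t + 1), y + 1) := by
  have h := kCoeff_time_right hp0 hp1 (u.2 + u.1.1 + n) (y + u.1.1 + n) (u.1.2 + t)
    (u.1.2 - 2 * u.1.1 - u.2)
  simp only [kRes]
  push_cast
  ring_nf at h ⊢
  linear_combination h

theorem phiRes_time_right (u : (ℤ × ℕ) × ℤ) (n : ℤ) (t : ℕ) (y : ℤ) :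
    phiRes p u ((n, t), y) =
      (1 - p) * phiRes p u ((n, t + 1), y) + p * phiRes p u ((n, t + 1), y + 1) := by
  have h := phiCoeff_time hp0 hp1 (n - u.1.1) (u.2 - y) (u.1.2 - t - 1)
  simp only [phiRes]
  push_cast
  ring_nf at h ⊢
  linear_combination h

theorem kRes_label_left (n : ℤ) (t : ℕ) (x : ℤ) (v : (ℤ × ℕ) × ℤ) :
    kRes p ((n - 1, t), x) v - kRes p ((n - 1, t), x - 1) v =
      (1 - p) * kRes p ((n, t), x - 1) v + p * kRes p ((n, t), x - 2) v := by
  have h := kCoeff_label_left hp0 hp1 (x + n + v.1.1 - 1) (v.2 + n + v.1.1 - 1) (t + v.1.2)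
    (t - 2 * n - x + 1)
  simp only [kRes]
  ring_nf at h ⊢
  linear_combination h

theorem phiRes_label_left (n : ℤ) (t : ℕ) (x : ℤ) (v : (ℤ × ℕ) × ℤ) :
    phiRes p ((n - 1, t), x) v - phiRes p ((n - 1, t), x - 1) v =
      (1 - p) * phiRes p ((n, t), x - 1) v + p * phiRes p ((n, t), x - 2) v := by
  have h := phiCoeff_label hp0 hp1 (v.1.1 - n) (x - v.2) (t - v.1.2)
  simp only [phiRes]
  ring_nf at h ⊢
  linear_combination h

theorem kRes_flip (u : (ℤ × ℕ) × ℤ) (n : ℤ) (t : ℕ) (b : ℤ) :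
    kRes p u ((n, t + 1), b - 1) =
      kRes p u ((n, t), b - 1) + p * kRes p u ((n - 1, t), b) := by
  have h := kCoeff_flip hp0 hp1 (u.2 + u.1.1 + n) (b + u.1.1 + n - 1) (u.1.2 + t)
    (u.1.2 - 2 * u.1.1 - u.2)
  simp only [kRes]
  push_cast
  ring_nf at h ⊢
  linear_combination h

theorem phiRes_flip (u : (ℤ × ℕ) × ℤ) (n : ℤ) (t : ℕ) (b : ℤ) :
    phiRes p u ((n, t + 1), b - 1) =
      phiRes p u ((n, t), b - 1) + p * phiRes p u ((n - 1, t), b) := by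
  have h := phiCoeff_flip hp0 hp1 (n - u.1.1) (u.2 - b + 1) (u.1.2 - t)
  simp only [phiRes]
  push_cast
  ring_nf at h ⊢
  linear_combination h


/-- By `hv`, the rows at `(n, t + 1)` and `(n, t)` carry `φ` in the same columns, except those at
`(n, t + 1)` itself. There only the first row has it, and it is the identity. -/
theorem complKernel_time_left {n : ℤ} {t : ℕ} {v : (ℤ × ℕ) × ℤ}
    (hv : SpaceLikeLE (n, t + 1) v.1 → v.1 = (n, t + 1) ∨ SpaceLikeLE (n, t) v.1) (x : ℤ) :
    complKernel p ((n, t + 1), x) v = (if ((n, t + 1), x) = v then 1 else 0) +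
      ((1 - p) * complKernel p ((n, t), x) v + p * complKernel p ((n, t), x - 1) v) := by
  obtain ⟨c, y⟩ := v
  simp only [complKernel, kRes_time_left hp0 hp1] at hv ⊢
  by_cases h1 : c = (n, t + 1)
  · subst h1
    have h2 : ¬ SpaceLikeLE (n, t) (n, t + 1) := fun h => by simpa using h.2
    rw [if_pos ⟨le_rfl, le_rfl⟩, if_neg h2, if_neg h2, phiRes_self hp1]
    simp only [Prod.mk.injEq, true_and]
    ring
  · rw [if_neg (show ¬ ((n, t + 1), x) = (c, y) from fun h => h1 (congrArg Prod.fst h).symm)]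
    by_cases h2 : SpaceLikeLE (n, t) c
    · have h3 : SpaceLikeLE (n, t + 1) c := ⟨h2.1, h2.2.trans (Nat.le_succ t)⟩
      rw [if_pos h3, if_pos h2, if_pos h2, phiRes_time_left hp0 hp1]
      ring
    · have h3 : ¬ SpaceLikeLE (n, t + 1) c := fun h => (hv h).elim h1 h2
      rw [if_neg h3, if_neg h2, if_neg h2]
      ring

omit hp0 hp1 in
-- Telescoping from the left edge: the weights `1 - p` and `p` from consecutive differences add up
-- to `1` at every site except the last, `x - 1`.
theorem eq_sum_of_sub_eq {F G : ℤ → ℂ} {l : ℤ} {p : ℂ}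
    (h : ∀ x, F x - F (x - 1) = (1 - p) * G (x - 1) + p * G (x - 2))
    (hF : ∀ x ≤ l, F x = 0) (hG : ∀ x < l, G x = 0) (x : ℤ) :
    F x = (1 - p) * G (x - 1) + ∑ y ∈ Finset.Ico l (x - 1), G y := by
  rcases le_total x l with hx | hx
  · rw [hF x hx, hG (x - 1) (by omega), Finset.Ico_eq_empty (by omega)]
    simp
  · induction x, hx using Int.leInduction with
    | base =>
      rw [hF l le_rfl, hG (l - 1) (by omega), Finset.Ico_eq_empty (by omega)]
      simp
    | succ x hx ih =>
      have h1 := h (x + 1)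
      rw [add_sub_cancel_right, show x + 1 - 2 = x - 1 by ring, ih] at h1
      rw [add_sub_cancel_right]
      rcases eq_or_lt_of_le hx with h2 | h2
      · subst h2
        rw [Finset.Ico_eq_empty (by omega), hG (l - 1) (by omega)] at h1
        simp only [Finset.Ico_self, Finset.sum_empty] at h1 ⊢
        linear_combination h1
      · have h3 : Finset.Ico l x = insert (x - 1) (Finset.Ico l (x - 1)) := by
          ext y
          simp only [Finset.mem_insert, Finset.mem_Ico]
          omega
        rw [h3, Finset.sum_insert (by simp)]
        linear_combination h1

theorem complKernel_label_left {n : ℤ} {t : ℕ} {N : ℤ} {v : (ℤ × ℕ) × ℤ} (hN : v.1.1 ≤ N)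
    (hN' : -N ≤ v.2 + v.1.1)
    (hv : SpaceLikeLE (n - 1, t) v.1 → v.1 = (n - 1, t) ∨ SpaceLikeLE (n, t) v.1) (x : ℤ) :
    complKernel p ((n - 1, t), x) v = (if ((n - 1, t), x) = v then 1 else 0) +
      ((1 - p) * complKernel p ((n, t), x - 1) v +
        ∑ y ∈ Finset.Ico (-N - n) (x - 1), complKernel p ((n, t), y) v) := by
  have hk := eq_sum_of_sub_eq (F := fun x => kRes p ((n - 1, t), x) v)
    (G := fun x => kRes p ((n, t), x) v) (l := -N - n)
    (fun x => kRes_label_left hp0 hp1 n t x v)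
    (fun x hx => kRes_eq_zero hp0 hp1 (by simp only; omega))
    (fun x hx => kRes_eq_zero hp0 hp1 (by simp only; omega)) x
  have hf := eq_sum_of_sub_eq (F := fun x => phiRes p ((n - 1, t), x) v)
    (G := fun x => phiRes p ((n, t), x) v) (l := -N - n)
    (fun x => phiRes_label_left hp0 hp1 n t x v)
    (fun x hx => phiRes_eq_zero hp0 hp1 (by simp only; omega))
    (fun x hx => phiRes_eq_zero hp0 hp1 (by simp only; omega)) x
  obtain ⟨c, z⟩ := v
  simp only [complKernel, Finset.sum_sub_distrib] at hv hk hf ⊢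
  by_cases h1 : c = (n - 1, t)
  · subst h1
    have h2 : ¬ SpaceLikeLE (n, t) (n - 1, t) := fun h => by
      have := h.1
      simp only at this
      omega
    rw [if_pos ⟨le_rfl, le_rfl⟩, if_neg h2, phiRes_self hp1]
    simp only [Prod.mk.injEq, true_and, if_neg h2, Finset.sum_const_zero]
    linear_combination -hk
  · rw [if_neg (show ¬ ((n - 1, t), x) = (c, z) from fun h => h1 (congrArg Prod.fst h).symm)]
    by_cases h2 : SpaceLikeLE (n, t) c
    · have h3 : SpaceLikeLE (n - 1, t) c := ⟨by have := h2.1; simp only at this ⊢; omega, h2.2⟩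
      simp only [if_pos h3, if_pos h2]
      linear_combination hf - hk
    · have h3 : ¬ SpaceLikeLE (n - 1, t) c := fun h => (hv h).elim h1 h2
      simp only [if_neg h3, if_neg h2, Finset.sum_const_zero]
      linear_combination -hk

theorem complKernel_time_right {n : ℤ} {t : ℕ} {u : (ℤ × ℕ) × ℤ}
    (hu : SpaceLikeLE u.1 (n, t) → u.1 = (n, t) ∨ SpaceLikeLE u.1 (n, t + 1)) (y : ℤ) :
    complKernel p u ((n, t), y) = (if u = ((n, t), y) then 1 else 0) +
      ((1 - p) * complKernel p u ((n, t + 1), y) + p * complKernel p u ((n, t + 1), y + 1)) := by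
  obtain ⟨c, x⟩ := u
  simp only [complKernel, kRes_time_right hp0 hp1 (c, x) n t] at hu ⊢
  by_cases h1 : c = (n, t)
  · subst h1
    have h2 : ¬ SpaceLikeLE (n, t) (n, t + 1) := fun h => by simpa using h.2
    rw [if_pos ⟨le_rfl, le_rfl⟩, if_neg h2, if_neg h2, phiRes_self hp1]
    simp only [Prod.mk.injEq, true_and]
    ring
  · rw [if_neg (show ¬ (c, x) = ((n, t), y) from fun h => h1 (congrArg Prod.fst h))]
    by_cases h2 : SpaceLikeLE c (n, t + 1)
    · have h3 : SpaceLikeLE c (n, t) := ⟨h2.1, (Nat.le_succ t).trans h2.2⟩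
      rw [if_pos h3, if_pos h2, if_pos h2, phiRes_time_right hp0 hp1 (c, x) n t]
      ring
    · have h3 : ¬ SpaceLikeLE c (n, t) := fun h => (hu h).elim h1 h2
      rw [if_neg h3, if_neg h2, if_neg h2]
      ring

/-- In the allowed positions of `u`, either all three columns carry `φ`, or none does, or `u` sits
at `(n, t)` and only the column at `(n, t)` does; the subtracted unit entry removes it in the last
case. -/
theorem complKernel_flip {n : ℤ} {t : ℕ} {u : (ℤ × ℕ) × ℤ}
    (hu : u.1 = (n, t) ∨
      (SpaceLikeLE u.1 (n - 1, t) ∧ SpaceLikeLE u.1 (n, t + 1)) ∨ ¬ SpaceLikeLE u.1 (n, t))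
    (b : ℤ) :
    complKernel p u ((n, t + 1), b - 1) = complKernel p u ((n, t), b - 1) +
      p * complKernel p u ((n - 1, t), b) - if u = ((n, t), b - 1) then 1 else 0 := by
  obtain ⟨c, x⟩ := u
  simp only [complKernel, kRes_flip hp0 hp1 (c, x) n t] at hu ⊢
  by_cases h1 : c = (n, t)
  · subst h1
    have h2 : ¬ SpaceLikeLE (n, t) (n, t + 1) := fun h => by simpa using h.2
    have h3 : ¬ SpaceLikeLE (n, t) (n - 1, t) := fun h => by
      have := h.1
      simp only at this
      omega
    rw [if_pos (show SpaceLikeLE (n, t) (n, t) from ⟨le_rfl, le_rfl⟩), if_neg h2, if_neg h3,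
      phiRes_self hp1]
    simp only [Prod.mk.injEq, true_and]
    ring
  · rw [if_neg (show ¬ (c, x) = ((n, t), b - 1) from fun h => h1 (congrArg Prod.fst h))]
    rcases hu with h | ⟨h2, h3⟩ | h2
    · exact absurd h h1
    · have h4 : SpaceLikeLE c (n, t) := ⟨h3.1, h2.2⟩
      rw [if_pos h2, if_pos h3, if_pos h4, phiRes_flip hp0 hp1 (c, x) n t]
      ring
    · have h3 : ¬ SpaceLikeLE c (n, t + 1) := fun h => h2 ⟨h.1, (Nat.le_succ t).trans h.2⟩
      have h4 : ¬ SpaceLikeLE c (n - 1, t) := fun h => h2 ⟨h.1.trans (by simp), h.2⟩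
      rw [if_neg h2, if_neg h3, if_neg h4]
      ring

end

/-! ### Determinants of finite minors under row and column relations -/

section
variable {ι : Type*} [DecidableEq ι]

/-- The determinant of the finite matrix `(M i j)`, `i, j ∈ A`. -/
def minorDet (M : ι → ι → ℂ) (A : Finset ι) : ℂ := Matrix.det (Matrix.of fun i j : A => M i j)

/-- The block of `M` with rows in `A` and columns in `B`. -/
def minorBlock (M : ι → ι → ℂ) (A B : Finset ι) : Matrix A B ℂ := Matrix.of fun i j => M i j

theorem minorDet_transpose (M : ι → ι → ℂ) (A : Finset ι) :
    minorDet (fun i j => M j i) A = minorDet M A := by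
  rw [minorDet, ← Matrix.det_transpose]
  rfl

theorem minorDet_union (M : ι → ι → ℂ) {B C : Finset ι} (h : Disjoint B C) :
    minorDet M (B ∪ C) = (Matrix.fromBlocks (minorBlock M B B) (minorBlock M B C)
      (minorBlock M C B) (minorBlock M C C)).det := by
  rw [minorDet, ← Matrix.det_submatrix_equiv_self (Equiv.Finset.union B C h)]
  congr 1
  ext (i | i) (j | j) <;> rfl

/-- Subtracting `Q` times the rows of `B` turns the rows of `C` into `(0, 1)`. -/
theorem minorDet_union_of_rows {M : ι → ι → ℂ} {B C : Finset ι} (h : Disjoint B C)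
    (Q : ι → ι → ℂ)
    (hQ : ∀ u ∈ C, ∀ v ∈ B ∪ C, M u v = (if u = v then 1 else 0) + ∑ b ∈ B, Q u b * M b v) :
    minorDet M (B ∪ C) = minorDet M B := by
  have key : Matrix.fromBlocks 1 0 (-minorBlock Q C B) 1 *
      Matrix.fromBlocks (minorBlock M B B) (minorBlock M B C)
      (minorBlock M C B) (minorBlock M C C) =
      Matrix.fromBlocks (minorBlock M B B) (minorBlock M B C) 0 1 := by
    rw [Matrix.fromBlocks_multiply]
    congr 1
    · simp
    · simp
    · ext ⟨i, hi⟩ ⟨j, hj⟩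
      have h1 := hQ i hi j (Finset.mem_union_left _ hj)
      rw [if_neg (ne_of_mem_of_not_mem hj (Finset.disjoint_right.1 h hi)).symm, ← Finset.sum_coe_sort] at h1
      simp [Matrix.mul_apply, minorBlock, h1]
    · ext ⟨i, hi⟩ ⟨j, hj⟩
      have h1 := hQ i hi j (Finset.mem_union_right _ hj)
      rw [← Finset.sum_coe_sort] at h1
      simp [Matrix.mul_apply, minorBlock, h1, Matrix.one_apply]
  have := congrArg Matrix.det key
  rw [Matrix.det_mul, Matrix.det_fromBlocks_zero₁₂, Matrix.det_fromBlocks_zero₂₁,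
    Matrix.det_one, Matrix.det_one, one_mul, one_mul, mul_one] at this
  rw [minorDet_union M h, this]
  rfl

theorem minorDet_union_of_cols {M : ι → ι → ℂ} {B C : Finset ι} (h : Disjoint B C)
    (Q : ι → ι → ℂ)
    (hQ : ∀ v ∈ C, ∀ u ∈ B ∪ C, M u v = (if u = v then 1 else 0) + ∑ b ∈ B, Q v b * M u b) :
    minorDet M (B ∪ C) = minorDet M B := by
  rw [← minorDet_transpose M, ← minorDet_transpose M]
  refine minorDet_union_of_rows h Q fun u hu v hv => ?_
  rw [hQ u hu v hv]
  simp only [eq_comm]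

/-- The determinant of a square matrix bordered by the column `g`, the row `r` and the corner
`f`. -/
def borderedDet {β : Type*} [Fintype β] [DecidableEq β] (A : Matrix β β ℂ) (g r : β → ℂ) (f : ℂ) :
    ℂ :=
  (Matrix.fromBlocks A (Matrix.of fun i (_ : Unit) => g i) (Matrix.of fun (_ : Unit) j => r j)
    (Matrix.of fun _ _ => f)).det

section
variable {β : Type*} [Fintype β] [DecidableEq β] (A : Matrix β β ℂ)

theorem borderedDet_transpose (g r : β → ℂ) (f : ℂ) :
    borderedDet A.transpose r g f = borderedDet A g r f := by
  rw [borderedDet, borderedDet, ← Matrix.det_transpose, Matrix.fromBlocks_transpose]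
  rfl

theorem borderedDet_add_smul_col (g₁ g₂ r : β → ℂ) (f₁ f₂ c : ℂ) :
    borderedDet A (fun i => g₁ i + c * g₂ i) r (f₁ + c * f₂) =
      borderedDet A g₁ r f₁ + c * borderedDet A g₂ r f₂ := by
  have upd : ∀ (g : β → ℂ) (f : ℂ), borderedDet A g r f =
      ((Matrix.fromBlocks A 0 (Matrix.of fun (_ : Unit) j => r j) 0).updateCol (Sum.inr ())
        (Sum.elim g fun _ => f)).det := by
    intro g f
    rw [borderedDet]
    congr 1
    ext (i | i) (j | j) <;> simp
  rw [upd, upd, upd, ← smul_eq_mul c, ← Matrix.det_updateCol_smul, ← Matrix.det_updateCol_add]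
  congr 2
  ext (i | i) <;> simp

theorem borderedDet_add_smul_row (g r₁ r₂ : β → ℂ) (f₁ f₂ c : ℂ) :
    borderedDet A g (fun i => r₁ i + c * r₂ i) (f₁ + c * f₂) =
      borderedDet A g r₁ f₁ + c * borderedDet A g r₂ f₂ := by
  simp only [← borderedDet_transpose A]
  exact borderedDet_add_smul_col _ _ _ _ _ _ _

theorem borderedDet_zero_col (r : β → ℂ) (f : ℂ) :
    borderedDet A (fun _ => 0) r f = A.det * f := by
  rw [borderedDet, show (Matrix.of fun (_ : β) (_ : Unit) => (0 : ℂ)) = 0 from rfl,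
    Matrix.det_fromBlocks_zero₁₂]
  simp

theorem borderedDet_zero_row (g : β → ℂ) (f : ℂ) :
    borderedDet A g (fun _ => 0) f = A.det * f := by
  rw [← borderedDet_transpose, borderedDet_zero_col, Matrix.det_transpose]

theorem borderedDet_row_operation (g r q : β → ℂ) (f : ℂ) :
    borderedDet A g (fun j => r j + ∑ i, q i * A i j) (f + ∑ i, q i * g i) =
      borderedDet A g r f := by
  have key : Matrix.fromBlocks 1 0 (Matrix.of fun (_ : Unit) j => q j) 1 *
      Matrix.fromBlocks A (Matrix.of fun i (_ : Unit) => g i) (Matrix.of fun (_ : Unit) j => r j)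
        (Matrix.of fun _ _ => f) =
      Matrix.fromBlocks A (Matrix.of fun i (_ : Unit) => g i)
        (Matrix.of fun (_ : Unit) j => r j + ∑ i, q i * A i j)
        (Matrix.of fun _ _ => f + ∑ i, q i * g i) := by
    rw [Matrix.fromBlocks_multiply]
    congr 1
    · simp
    · simp
    · ext i j
      simp [Matrix.mul_apply, add_comm]
    · ext i j
      simp [Matrix.mul_apply, add_comm]
  rw [borderedDet, ← key, Matrix.det_mul, Matrix.det_fromBlocks_zero₁₂]
  simp [borderedDet]

end

theorem minorDet_insert (M : ι → ι → ℂ) {B : Finset ι} {u : ι} (hu : u ∉ B) :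
    minorDet M (insert u B) =
      borderedDet (minorBlock M B B) (fun i => M i u) (fun j => M u j) (M u u) := by
  rw [borderedDet, minorDet, ← Matrix.det_submatrix_equiv_self (Equiv.sumCongr (Equiv.refl B)
    (Equiv.ofUnique Unit ({u} : Finset ι)) |>.trans ((Equiv.Finset.union B {u}
      (Finset.disjoint_singleton_right.2 hu)).trans (Equiv.subtypeEquivRight fun x => by
        rw [Finset.union_comm]; rfl)))]
  congr 1
  ext (i | i) (j | j) <;> rfl

/-- The rows of `B` are subtracted from row `u`, and the rest is split by linearity into a unit row
and `c` times row `u₀`. The border column stays at `u`, so the last term is in general not a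
principal minor. -/
theorem minorDet_insert_of_row {M : ι → ι → ℂ} {B : Finset ι} {u u₀ : ι} (hu : u ∉ B) {c : ℂ}
    (q : ι → ℂ) (h : ∀ v ∈ insert u B,
      M u v = (if u = v then 1 else 0) + (c * M u₀ v + ∑ b ∈ B, q b * M b v)) :
    minorDet M (insert u B) = (minorBlock M B B).det +
      c * borderedDet (minorBlock M B B) (fun i => M i u) (fun j => M u₀ j) (M u₀ u) := by
  have h1 : ∀ j : B, M u j = 0 + c * M u₀ j + ∑ i : B, q i * minorBlock M B B i j := fun j => by
    rw [h j (Finset.mem_insert_of_mem j.2), if_neg (ne_of_mem_of_not_mem j.2 hu).symm,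
      ← Finset.sum_coe_sort, add_assoc]
    rfl
  have h2 : M u u = 1 + c * M u₀ u + ∑ i : B, q i * M i u := by
    rw [h u (Finset.mem_insert_self _ _), if_pos rfl, ← Finset.sum_coe_sort, add_assoc]
  rw [minorDet_insert M hu]
  conv_lhs => rw [h2, funext h1]
  rw [borderedDet_row_operation _ (fun i : B => M i u) (fun j : B => 0 + c * M u₀ j) (fun i => q i),
    borderedDet_add_smul_row, borderedDet_zero_row, mul_one]

/-- Let `D(r, c)` be the determinant of the block `B` bordered by row `r` and column `c`. The row
relations say that adding `uᵢ`, `i = 1, 2`, to `B` gives `det B + (1 - p) D(u₀, uᵢ)`. The column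
relation says `D(u₀, u₂) = D(u₀, u₀) + p D(u₀, u₁) - det B`. Eliminating `D(u₀, u₁)` and `D(u₀, u₂)`
also cancels `det B`. -/
theorem minorDet_flip {M : ι → ι → ℂ} {B : Finset ι} {u₀ u₁ u₂ : ι} {p : ℂ}
    (h₀ : u₀ ∉ B) (h₁ : u₁ ∉ B) (h₂ : u₂ ∉ B) (q₁ q₂ : ι → ℂ)
    (hr₁ : ∀ v ∈ insert u₁ B,
      M u₁ v = (if u₁ = v then 1 else 0) + ((1 - p) * M u₀ v + ∑ b ∈ B, q₁ b * M b v))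
    (hr₂ : ∀ v ∈ insert u₂ B,
      M u₂ v = (if u₂ = v then 1 else 0) + ((1 - p) * M u₀ v + ∑ b ∈ B, q₂ b * M b v))
    (hc : ∀ u ∈ insert u₀ B, M u u₂ = M u u₀ + p * M u u₁ - if u = u₀ then 1 else 0) :
    minorDet M (insert u₂ B) =
      (1 - p) * minorDet M (insert u₀ B) + p * minorDet M (insert u₁ B) := by
  rw [minorDet_insert_of_row h₁ q₁ hr₁, minorDet_insert_of_row h₂ q₂ hr₂, minorDet_insert M h₀]
  have h1 : ∀ i : B, M i u₂ = (M i u₀ + p * M i u₁) + (-1) * 0 := fun i => by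
    rw [hc i (Finset.mem_insert_of_mem i.2), if_neg (ne_of_mem_of_not_mem i.2 h₀)]
    ring
  have h2 : M u₀ u₂ = (M u₀ u₀ + p * M u₀ u₁) + (-1) * 1 := by
    rw [hc u₀ (Finset.mem_insert_self _ _), if_pos rfl]
    ring
  rw [h2, funext h1, borderedDet_add_smul_col, borderedDet_add_smul_col, borderedDet_zero_col]
  ring

end

/-! ### Determinants on finite windows and their recursion -/

/-- The points `(c, x)` with `c ∈ S` and `-N - n ≤ x < a c`, where `n` is the label of `c`. -/
def window (N : ℤ) (S : Finset (ℤ × ℕ)) (a : ℤ × ℕ → ℤ) : Finset ((ℤ × ℕ) × ℤ) :=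
  S.biUnion fun c => (Finset.Ico (-N - c.1) (a c)).image fun x => (c, x)

theorem mem_window {N : ℤ} {S : Finset (ℤ × ℕ)} {a : ℤ × ℕ → ℤ} {u : (ℤ × ℕ) × ℤ} :
    u ∈ window N S a ↔ u.1 ∈ S ∧ -N - u.1.1 ≤ u.2 ∧ u.2 < a u.1 := by
  obtain ⟨c, x⟩ := u
  simp only [window, Finset.mem_biUnion, Finset.mem_image, Finset.mem_Ico, Prod.mk.injEq]
  constructor
  · rintro ⟨c', hc', y, hy, rfl, rfl⟩
    exact ⟨hc', hy⟩
  · rintro ⟨hc, hx⟩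
    exact ⟨c, hc, x, hx, rfl, rfl⟩

/-- The determinant of `1 - K` on a window. -/
def gapDet (p : ℝ) (N : ℤ) (S : Finset (ℤ × ℕ)) (a : ℤ × ℕ → ℤ) : ℂ :=
  minorDet (complKernel p) (window N S a)

theorem gapDet_congr (p : ℝ) (N : ℤ) {S : Finset (ℤ × ℕ)} {a a' : ℤ × ℕ → ℤ}
    (h : ∀ c ∈ S, a c = a' c) : gapDet p N S a = gapDet p N S a' := by
  have : window N S a = window N S a' := by
    ext u
    simp only [mem_window]
    exact and_congr_right fun hu => by rw [h _ hu]
  rw [gapDet, this, gapDet]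

/-- `c` precedes `(n, t)` in a space-like way and has time `t + 1`, or it comes after `(n, t)`. -/
def FlipCompatible (n : ℤ) (t : ℕ) (c : ℤ × ℕ) : Prop :=
  (c.1 < n ∧ c.2 = t + 1) ∨ (n ≤ c.1 ∧ c.2 ≤ t ∧ c ≠ (n, t))

section
variable {n : ℤ} {t : ℕ} {c : ℤ × ℕ}

theorem FlipCompatible.time_left (h : FlipCompatible n t c ∨ c = (n, t) ∨ c = (n, t + 1)) :
    SpaceLikeLE (n, t + 1) c → c = (n, t + 1) ∨ SpaceLikeLE (n, t) c := by
  obtain ⟨m, s⟩ := c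
  simp only [FlipCompatible, SpaceLikeLE, Prod.mk.injEq, ne_eq] at h ⊢
  omega

theorem FlipCompatible.label_left (h : FlipCompatible n t c ∨ c = (n, t) ∨ c = (n - 1, t)) :
    SpaceLikeLE (n - 1, t) c → c = (n - 1, t) ∨ SpaceLikeLE (n, t) c := by
  obtain ⟨m, s⟩ := c
  simp only [FlipCompatible, SpaceLikeLE, Prod.mk.injEq, ne_eq] at h ⊢
  omega

theorem FlipCompatible.time_right (h : FlipCompatible n t c ∨ c = (n, t) ∨ c = (n, t + 1)) :
    SpaceLikeLE c (n, t) → c = (n, t) ∨ SpaceLikeLE c (n, t + 1) := by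
  obtain ⟨m, s⟩ := c
  simp only [FlipCompatible, SpaceLikeLE, Prod.mk.injEq, ne_eq] at h ⊢
  omega

theorem FlipCompatible.flip (h : FlipCompatible n t c ∨ c = (n, t)) :
    c = (n, t) ∨ (SpaceLikeLE c (n - 1, t) ∧ SpaceLikeLE c (n, t + 1)) ∨
      ¬ SpaceLikeLE c (n, t) := by
  obtain ⟨m, s⟩ := c
  simp only [FlipCompatible, SpaceLikeLE, Prod.mk.injEq, ne_eq] at h ⊢
  omega

theorem FlipCompatible.ne (h : FlipCompatible n t c) :
    c ≠ (n, t) ∧ c ≠ (n, t + 1) ∧ c ≠ (n - 1, t) := by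
  obtain ⟨m, s⟩ := c
  simp only [FlipCompatible, Prod.mk.injEq, ne_eq] at h ⊢
  omega

end

section
variable {p : ℝ} (hp0 : 0 < p) (hp1 : p < 1) {N : ℤ} {n : ℤ} {t : ℕ} {R : Finset (ℤ × ℕ)}
  (hR : ∀ c ∈ R, c.1 ≤ N ∧ FlipCompatible n t c) (hn : n ≤ N)

/-- The sites `i` and `j` may fall outside of `B` when `f` vanishes there, as happens at the left
edge of a window. -/
theorem sum_two_mul {ι : Type*} [DecidableEq ι] (B : Finset ι) {i j : ι} (α β : ℂ) {f : ι → ℂ}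
    (hi : i ∉ B → f i = 0) (hj : j ∉ B → f j = 0) :
    ∑ b ∈ B, ((if b = i then α else 0) + if b = j then β else 0) * f b = α * f i + β * f j := by
  have h : ∀ {k : ι} (γ : ℂ), (k ∉ B → f k = 0) →
      ∑ b ∈ B, (if b = k then γ else 0) * f b = γ * f k := by
    intro k γ hk
    simp only [ite_mul, zero_mul, Finset.sum_ite_eq']
    split_ifs with hB
    · rfl
    · rw [hk hB, mul_zero]
  simp only [add_mul, Finset.sum_add_distrib, h α hi, h β hj]

theorem sum_fiber_mul {ι κ : Type*} [DecidableEq ι] [DecidableEq κ] (B : Finset (ι × κ))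
    {i : ι} {I : Finset κ} {f : ι × κ → ℂ} (hI : ∀ k ∈ I, (i, k) ∈ B) :
    ∑ b ∈ B, (if b.1 = i ∧ b.2 ∈ I then 1 else 0) * f b = ∑ k ∈ I, f (i, k) := by
  simp only [ite_mul, one_mul, zero_mul]
  rw [← Finset.sum_filter]
  symm
  refine Finset.sum_bij (fun k _ => (i, k)) (fun k hk => by simp [hI k hk, hk])
    (fun a _ b _ h => (Prod.mk.inj h).2) ?_ (fun _ _ => rfl)
  rintro ⟨b1, b2⟩ hb
  simp only [Finset.mem_filter] at hb
  exact ⟨b2, hb.2.2, by rw [hb.2.1]⟩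

include hp0 hp1 hR hn

/-- Rows at `(n, t + 1)` are obtained from rows at `(n, t)`. -/
theorem minorDet_union_time_rows {B C : Finset ((ℤ × ℕ) × ℤ)}
    (hB : ∀ u ∈ B, (u.1 ∈ R ∨ u.1 = (n, t) ∨ u.1 = (n, t + 1)) ∧ -N - u.1.1 ≤ u.2)
    (hC : ∀ u ∈ C, u.1 = (n, t + 1) ∧ -N - n ≤ u.2) (hBC : Disjoint B C)
    (hw : ∀ u ∈ C, ∀ y, -N - n ≤ y → y ≤ u.2 → ((n, t), y) ∈ B) :
    minorDet (complKernel p) (B ∪ C) = minorDet (complKernel p) B := by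
  refine minorDet_union_of_rows hBC (fun u b => (if b = ((n, t), u.2) then 1 - (p : ℂ) else 0) +
    if b = ((n, t), u.2 - 1) then (p : ℂ) else 0) fun u hu v hv => ?_
  have hv' : (v.1 ∈ R ∨ v.1 = (n, t) ∨ v.1 = (n, t + 1)) ∧ -N - v.1.1 ≤ v.2 := by
    rcases Finset.mem_union.1 hv with h | h
    · exact hB v h
    · obtain ⟨h1, h2⟩ := hC v h
      exact ⟨Or.inr (Or.inr h1), by rw [h1]; exact h2⟩
  have hvN : v.1.1 ≤ N := by
    rcases hv'.1 with h | h | h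
    · exact (hR _ h).1
    · rw [h]; exact hn
    · rw [h]; exact hn
  -- A site at `(n, t)` not beyond `u` that is missing from `B` lies left of the window, where rows
  -- are zero.
  have low : ∀ y ≤ u.2, ((n, t), y) ∉ B → complKernel p ((n, t), y) v = 0 := fun y hy hyB => by
    refine complKernel_eq_zero_of_low hp0 hp1 hvN (by linarith [hv'.2]) ?_
    by_contra hcon
    refine hyB (hw u hu y ?_ hy)
    simp only at hcon
    omega
  obtain ⟨c, x⟩ := u
  obtain ⟨rfl, hx⟩ : c = (n, t + 1) ∧ -N - n ≤ x := hC _ hu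
  rw [sum_two_mul B (f := fun b => complKernel p b v) _ _ (low _ le_rfl) (low _ (by simp)),
    complKernel_time_left hp0 hp1
      (FlipCompatible.time_left (hv'.1.imp (fun h => (hR _ h).2) id))]

/-- A row at `(n, t + 1)` and position `x` combines the rows at `(n, t)` and `x`, `x - 1`; by `ha`
these are in the window or vanish. It mirrors `x_n(t) ≤ x_n(t+1)`. -/
theorem gapDet_insert_time {a : ℤ × ℕ → ℤ} (ha : a (n, t + 1) ≤ a (n, t)) :
    gapDet p N (insert (n, t + 1) (insert (n, t) R)) a = gapDet p N (insert (n, t) R) a := by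
  have h : window N (insert (n, t + 1) (insert (n, t) R)) a =
      window N (insert (n, t) R) a ∪ window N {(n, t + 1)} a := by
    ext u
    simp only [Finset.mem_union, mem_window, Finset.mem_insert, Finset.mem_singleton]
    tauto
  rw [gapDet, gapDet, h]
  refine minorDet_union_time_rows hp0 hp1 hR hn ?_ ?_ ?_ ?_
  · intro u hu
    simp only [mem_window, Finset.mem_insert] at hu
    exact ⟨by tauto, hu.2.1⟩
  · intro u hu
    simp only [mem_window, Finset.mem_singleton] at hu
    exact ⟨hu.1, by have := hu.2.1; rwa [hu.1] at this⟩
  · rw [Finset.disjoint_left]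
    intro u hu hu'
    simp only [mem_window, Finset.mem_insert, Finset.mem_singleton] at hu hu'
    rcases hu.1 with h | h
    · rw [hu'.1] at h
      simp at h
    · exact (hR _ h).2.ne.2.1 hu'.1
  · intro u hu y hy hyu
    simp only [mem_window, Finset.mem_singleton] at hu
    have h2 := hu.2.2
    rw [hu.1] at h2
    simp only [mem_window, Finset.mem_insert_self, true_and]
    omega

omit hn in
-- Now columns: the one at `(n, t)` and `y` combines those at `(n, t + 1)` and `y`, `y + 1`, and
-- `ha` leaves room for `y + 1`. It mirrors `x_n(t+1) ≤ x_n(t) + 1`.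
theorem gapDet_insert_vacuous {a : ℤ × ℕ → ℤ} (ha : a (n, t) < a (n, t + 1)) :
    gapDet p N (insert (n, t) (insert (n, t + 1) R)) a =
      gapDet p N (insert (n, t + 1) R) a := by
  have h : window N (insert (n, t) (insert (n, t + 1) R)) a =
      window N (insert (n, t + 1) R) a ∪ window N {(n, t)} a := by
    ext u
    simp only [Finset.mem_union, mem_window, Finset.mem_insert, Finset.mem_singleton]
    tauto
  rw [gapDet, gapDet, h]
  refine minorDet_union_of_cols ?_ (fun v b => (if b = ((n, t + 1), v.2) then 1 - (p : ℂ) else 0) +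
    if b = ((n, t + 1), v.2 + 1) then (p : ℂ) else 0) fun v hv u hu => ?_
  · rw [Finset.disjoint_left]
    intro u hu hu'
    simp only [mem_window, Finset.mem_insert, Finset.mem_singleton] at hu hu'
    rcases hu.1 with h | h
    · rw [hu'.1] at h
      simp at h
    · exact (hR _ h).2.ne.1 hu'.1
  · obtain ⟨c, y⟩ := v
    simp only [Finset.mem_union, mem_window, Finset.mem_insert, Finset.mem_singleton] at hu hv
    obtain ⟨rfl, hy⟩ := hv
    rw [sum_two_mul (window N (insert (n, t + 1) R) a) (f := fun b => complKernel p u b),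
      complKernel_time_right hp0 hp1 (FlipCompatible.time_right ?_)]
    · rcases hu with ⟨h | h, -⟩ | ⟨h, -⟩
      · exact Or.inr (Or.inr h)
      · exact Or.inl (hR _ h).2
      · exact Or.inr (Or.inl h)
    · intro hcon
      refine absurd ?_ hcon
      simp only [mem_window, Finset.mem_insert_self, true_and]
      simp only at hy
      omega
    · intro hcon
      refine absurd ?_ hcon
      simp only [mem_window, Finset.mem_insert_self, true_and]
      simp only at hy
      omega

/-- The constraint `b - 1` at `(n, t)` on the left side is vacuous; it is kept so that all three
windows contain the same `B`. Once redundant rows are dropped, each exceeds `B` by its topmost point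
only: `((n, t + 1), b - 1)`, `((n, t), b - 1)` and `((n - 1, t), b)`. The bound `hb` places these
points inside the windows. -/
theorem gapDet_flip (a : ℤ × ℕ → ℤ) {b : ℤ} (hb : -N - n < b) :
    gapDet p N (insert (n, t) (insert (n, t + 1) R))
        (Function.update (Function.update a (n, t + 1) b) (n, t) (b - 1)) =
      (1 - p) * gapDet p N (insert (n, t) R) (Function.update a (n, t) b) +
      p * gapDet p N (insert (n - 1, t) (insert (n, t) R))
        (Function.update (Function.update a (n - 1, t) (b + 1)) (n, t) (b - 1)) := by
  set B := window N (insert (n, t) R) (Function.update a (n, t) (b - 1)) with hBdef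
  have hne1 : ((n, t + 1) : ℤ × ℕ) ≠ (n, t) := by simp
  have hne2 : ((n - 1, t) : ℤ × ℕ) ≠ (n, t) := by simp
  have hRne : ∀ c ∈ R, c ≠ (n, t) ∧ c ≠ (n, t + 1) ∧ c ≠ (n - 1, t) := fun c hc => (hR c hc).2.ne
  have memB : ∀ u, u ∈ B ↔ (u.1 = (n, t) ∧ -N - n ≤ u.2 ∧ u.2 < b - 1) ∨
      (u.1 ∈ R ∧ -N - u.1.1 ≤ u.2 ∧ u.2 < a u.1) := by
    rintro ⟨c, x⟩
    simp only [hBdef, mem_window, Finset.mem_insert]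
    by_cases hc : c = (n, t)
    · subst hc
      have : (n, t) ∉ R := fun h => (hRne _ h).1 rfl
      simp [this]
    · simp [hc]
  have h0 : (((n, t), b - 1) : (ℤ × ℕ) × ℤ) ∉ B := by
    rw [memB]
    rintro (⟨-, -, h⟩ | ⟨h, -⟩)
    · exact lt_irrefl _ h
    · exact (hRne _ h).1 rfl
  have h1 : (((n - 1, t), b) : (ℤ × ℕ) × ℤ) ∉ B := by
    rw [memB]
    rintro (⟨h, -⟩ | ⟨h, -⟩)
    · exact hne2 h
    · exact (hRne _ h).2.2 rfl
  have h2 : (((n, t + 1), b - 1) : (ℤ × ℕ) × ℤ) ∉ B := by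
    rw [memB]
    rintro (⟨h, -⟩ | ⟨h, -⟩)
    · exact hne1 h
    · exact (hRne _ h).2.1 rfl
  have e0 : gapDet p N (insert (n, t) R) (Function.update a (n, t) b) =
      minorDet (complKernel p) (insert ((n, t), b - 1) B) := by
    rw [gapDet]
    congr 1
    ext ⟨c, x⟩
    simp only [Finset.mem_insert, memB, mem_window, Prod.mk.injEq]
    by_cases hc : c = (n, t)
    · subst hc
      have : (n, t) ∉ R := fun h => (hRne _ h).1 rfl
      simp [this]
      omega
    · simp [hc]
  have hBN : ∀ u ∈ B, u.1.1 ≤ N ∧ -N - u.1.1 ≤ u.2 ∧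
      (FlipCompatible n t u.1 ∨ u.1 = (n, t)) := fun u hu => by
    rcases (memB u).1 hu with ⟨h, h', -⟩ | ⟨h, h', -⟩
    · rw [h]
      exact ⟨hn, h', Or.inr rfl⟩
    · exact ⟨(hR _ h).1, h', Or.inl (hR _ h).2⟩
  -- For `x < b` the site `x - 1` belongs to `B`, so the row is redundant; for `x = b` it is `b -
  -- 1`, the point at `(n, t)` just above `B`.
  have row1 : ∀ x ≤ b, ∀ v : (ℤ × ℕ) × ℤ, (v ∈ B ∨ (v.1 = (n - 1, t) ∧ -N - n < v.2)) →
      complKernel p ((n - 1, t), x) v = (if ((n - 1, t), x) = v then 1 else 0) +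
        ((1 - p) * complKernel p ((n, t), x - 1) v +
        ∑ b ∈ B, (if b.1 = (n, t) ∧ b.2 ∈ Finset.Ico (-N - n) (x - 1) then 1 else 0) *
          complKernel p b v) := by
    intro x hx v hv
    have hv' : v.1.1 ≤ N ∧ -N ≤ v.2 + v.1.1 ∧
        (FlipCompatible n t v.1 ∨ v.1 = (n, t) ∨ v.1 = (n - 1, t)) := by
      rcases hv with h | ⟨h, h'⟩
      · obtain ⟨h1, h2, h3⟩ := hBN v h
        exact ⟨h1, by omega, h3.imp id Or.inl⟩
      · rw [h]
        exact ⟨by simp only; omega, by simp only; omega, Or.inr (Or.inr rfl)⟩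
    rw [sum_fiber_mul B (f := fun b => complKernel p b v) (fun k hk => ?_)]
    · exact complKernel_label_left hp0 hp1 hv'.1 hv'.2.1 (FlipCompatible.label_left hv'.2.2) x
    · rw [Finset.mem_Ico] at hk
      exact (memB _).2 (Or.inl ⟨rfl, hk.1, by simp only; omega⟩)
  have e1 : gapDet p N (insert (n - 1, t) (insert (n, t) R))
        (Function.update (Function.update a (n - 1, t) (b + 1)) (n, t) (b - 1)) =
      minorDet (complKernel p) (insert ((n - 1, t), b) B) := by
    have hw : window N (insert (n - 1, t) (insert (n, t) R))
        (Function.update (Function.update a (n - 1, t) (b + 1)) (n, t) (b - 1)) =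
        insert ((n - 1, t), b) B ∪ window N {(n - 1, t)} (fun _ => b) := by
      ext ⟨c, x⟩
      simp only [Finset.mem_union, Finset.mem_insert, memB, mem_window, Prod.mk.injEq,
        Finset.mem_singleton]
      by_cases hc : c = (n, t)
      · subst hc
        have : (n, t) ∉ R := fun h => (hRne _ h).1 rfl
        simp [this]
        omega
      · by_cases hc' : c = (n - 1, t)
        · subst hc'
          have : (n - 1, t) ∉ R := fun h => (hRne _ h).2.2 rfl
          simp [this]
          omega
        · simp [hc, hc']
    rw [gapDet, hw]
    have hC : ∀ u ∈ window N {(n - 1, t)} (fun _ => b),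
        u.1 = (n - 1, t) ∧ -N - n < u.2 ∧ u.2 < b := fun u hu => by
      simp only [mem_window, Finset.mem_singleton] at hu
      obtain ⟨h, h', h''⟩ := hu
      rw [h] at h'
      exact ⟨h, by simp only at h'; omega, h''⟩
    refine minorDet_union_of_rows ?_ (fun u β => (if β = ((n, t), u.2 - 1) then 1 - (p : ℂ) else 0) +
      if β.1 = (n, t) ∧ β.2 ∈ Finset.Ico (-N - n) (u.2 - 1) then 1 else 0) fun u hu v hv => ?_
    · rw [Finset.disjoint_left]
      intro u hu hu'
      obtain ⟨h3, h4, h5⟩ := hC u hu'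
      rcases Finset.mem_insert.1 hu with h | h
      · rw [h] at h5
        exact lt_irrefl _ h5
      · rcases (memB u).1 h with ⟨h, -⟩ | ⟨h, -⟩
        · exact hne2 (h3.symm.trans h)
        · exact (hRne _ h).2.2 h3
    · obtain ⟨c, x⟩ := u
      obtain ⟨h3, h4, h5⟩ := hC _ hu
      simp only at h3 h4 h5
      subst h3
      have hv' : v ∈ B ∨ (v.1 = (n - 1, t) ∧ -N - n < v.2) := by
        rcases Finset.mem_union.1 hv with h | h
        · rcases Finset.mem_insert.1 h with h | h
          · rw [h]
            exact Or.inr ⟨rfl, hb⟩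
          · exact Or.inl h
        · exact Or.inr ⟨(hC v h).1, (hC v h).2.1⟩
      have hxB : ((n, t), x - 1) ∈ B :=
        (memB _).2 (Or.inl ⟨rfl, by simp only; omega, by simp only; omega⟩)
      rw [row1 x h5.le v hv', Finset.sum_insert h1]
      simp only [add_mul, Finset.sum_add_distrib, ite_mul, zero_mul, Finset.sum_ite_eq', if_pos hxB,
        Prod.mk.injEq, hne2, false_and, if_false, zero_add]
  have e2 : gapDet p N (insert (n, t) (insert (n, t + 1) R))
        (Function.update (Function.update a (n, t + 1) b) (n, t) (b - 1)) =
      minorDet (complKernel p) (insert ((n, t + 1), b - 1) B) := by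
    have hw : window N (insert (n, t) (insert (n, t + 1) R))
        (Function.update (Function.update a (n, t + 1) b) (n, t) (b - 1)) =
        insert ((n, t + 1), b - 1) B ∪ window N {(n, t + 1)} (fun _ => b - 1) := by
      ext ⟨c, x⟩
      simp only [Finset.mem_union, Finset.mem_insert, memB, mem_window, Prod.mk.injEq,
        Finset.mem_singleton]
      by_cases hc : c = (n, t)
      · subst hc
        have : (n, t) ∉ R := fun h => (hRne _ h).1 rfl
        simp [this]
      · by_cases hc' : c = (n, t + 1)
        · subst hc'
          have : (n, t + 1) ∉ R := fun h => (hRne _ h).2.1 rfl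
          simp [this]
          omega
        · simp [hc, hc']
    rw [gapDet, hw]
    have hC : ∀ u ∈ window N {(n, t + 1)} (fun _ => b - 1),
        u.1 = (n, t + 1) ∧ -N - n ≤ u.2 ∧ u.2 < b - 1 := fun u hu => by
      simp only [mem_window, Finset.mem_singleton] at hu
      obtain ⟨h, h', h''⟩ := hu
      rw [h] at h'
      exact ⟨h, h', h''⟩
    refine minorDet_union_time_rows hp0 hp1 hR hn ?_ (fun u hu => ⟨(hC u hu).1, (hC u hu).2.1⟩) ?_ ?_
    · intro u hu
      rcases Finset.mem_insert.1 hu with h | h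
      · rw [h]
        exact ⟨Or.inr (Or.inr rfl), by simp only; omega⟩
      · rcases (memB u).1 h with ⟨h3, h4, -⟩ | ⟨h3, h4, -⟩
        · exact ⟨Or.inr (Or.inl h3), by rw [h3]; exact h4⟩
        · exact ⟨Or.inl h3, h4⟩
    · rw [Finset.disjoint_left]
      intro u hu hu'
      obtain ⟨h3, h4, h5⟩ := hC u hu'
      rcases Finset.mem_insert.1 hu with h | h
      · rw [h] at h5
        exact lt_irrefl _ h5
      · rcases (memB u).1 h with ⟨h, -⟩ | ⟨h, -⟩
        · exact hne1 (h3.symm.trans h)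
        · exact (hRne _ h).2.1 h3
    · intro u hu y hy hyu
      exact Finset.mem_insert_of_mem ((memB _).2 (Or.inl ⟨rfl, hy, hyu.trans_lt (hC u hu).2.2⟩))
  rw [e0, e1, e2]
  refine minorDet_flip h0 h1 h2
    (fun β => if β.1 = (n, t) ∧ β.2 ∈ Finset.Ico (-N - n) (b - 1) then 1 else 0)
    (fun β => if β = ((n, t), b - 2) then (p : ℂ) else 0) ?_ ?_ ?_
  · intro v hv
    refine row1 b le_rfl v ?_
    rcases Finset.mem_insert.1 hv with h | h
    · rw [h]
      exact Or.inr ⟨rfl, hb⟩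
    · exact Or.inl h
  · intro v hv
    have hv' : v.1.1 ≤ N ∧ -N - v.1.1 ≤ v.2 ∧
        (FlipCompatible n t v.1 ∨ v.1 = (n, t) ∨ v.1 = (n, t + 1)) := by
      rcases Finset.mem_insert.1 hv with h | h
      · rw [h]
        exact ⟨hn, by simp only; omega, Or.inr (Or.inr rfl)⟩
      · obtain ⟨h1, h2, h3⟩ := hBN v h
        exact ⟨h1, h2, h3.imp id Or.inl⟩
    rw [complKernel_time_left hp0 hp1 (FlipCompatible.time_left hv'.2.2)]
    congr 2
    rw [show b - 1 - 1 = b - 2 by ring]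
    simp only [ite_mul, zero_mul, Finset.sum_ite_eq']
    split_ifs with h
    · rfl
    -- If `b - 2` has left the window, it did so through the left edge, and its row is zero.
    · rw [complKernel_eq_zero_of_low hp0 hp1 hv'.1 (by linarith [hv'.2.1]) ?_, mul_zero]
      by_contra hcon
      refine h ((memB _).2 (Or.inl ⟨rfl, ?_, ?_⟩)) <;> simp only at hcon ⊢ <;> omega
  · intro u hu
    refine complKernel_flip hp0 hp1 (FlipCompatible.flip ?_) b
    rcases Finset.mem_insert.1 hu with h | h
    · rw [h]
      exact Or.inr rfl
    · exact (hBN u h).2.2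

end

/-! ### The determinant at time zero -/

section
variable {p : ℝ} (hp0 : 0 < p) (hp1 : p < 1) {N : ℤ} {S : Finset (ℤ × ℕ)} {a : ℤ × ℕ → ℤ}
include hp0 hp1

/-- When `x < -2 n` and `n' ≤ n`, the sum `x + n + n'` is negative and `K̃` vanishes. The matrix is
therefore block triangular in the label, with identity blocks on the diagonal. -/
theorem gapDet_initial_of_le (hS : ∀ c ∈ S, c.2 = 0) (ha : ∀ c ∈ S, a c ≤ -2 * c.1) :
    gapDet p N S a = 1 := by
  have h0 : ∀ u ∈ window N S a, ∀ v ∈ window N S a, v.1.1 ≤ u.1.1 →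
      complKernel p u v = if u = v then 1 else 0 := by
    rintro ⟨⟨n, t⟩, x⟩ hu ⟨⟨n', t'⟩, x'⟩ hv h
    rw [mem_window] at hu hv
    have ht : t = 0 := hS _ hu.1
    have ht' : t' = 0 := hS _ hv.1
    have hx := ha _ hu.1
    have hx' := hu.2.2
    simp only at hx hx' h
    subst ht ht'
    rw [complKernel, kRes_eq_zero hp0 hp1 (by simp only; omega), sub_zero]
    rcases eq_or_lt_of_le h with h1 | h1
    · subst h1
      rw [if_pos ⟨le_rfl, le_rfl⟩, phiRes_self hp1]
      simp
    · rw [if_neg (fun h2 : SpaceLikeLE _ _ => absurd h2.1 (by simpa using h1)), if_neg]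
      intro h2
      simp only [Prod.mk.injEq] at h2
      omega
  rw [gapDet, minorDet]
  have hbt : Matrix.BlockTriangular
      (Matrix.of fun i j : window N S a => complKernel p i j) (fun u => u.1.1.1) := by
    intro u v huv
    rw [Matrix.of_apply, h0 u u.2 v v.2 huv.le, if_neg]
    intro h
    simp only [h] at huv
    exact lt_irrefl _ huv
  rw [hbt.det]
  refine Finset.prod_eq_one fun k _ => ?_
  have : (Matrix.of fun i j : window N S a => complKernel p i j).toSquareBlock
      (fun u => u.1.1.1) k = 1 := by
    ext ⟨u, hu⟩ ⟨v, hv⟩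
    rw [Matrix.toSquareBlock_def, Matrix.of_apply, Matrix.of_apply,
      h0 u u.2 v v.2 (by rw [hu, hv]), Matrix.one_apply]
    simp only [Subtype.ext_iff]
  rw [this, Matrix.det_one]

/-- For rows of label `n` this is the flat initial condition, `kRes_flat`; `complKernel_label_left`
carries the zero to smaller labels. -/
theorem complKernel_flat_eq_zero {n : ℤ} (hn : n ≤ N) (k : ℕ) :
    ∀ x, complKernel p ((n - k, 0), x) ((n, 0), -2 * n) = 0 := by
  induction k with
  | zero =>
    intro x
    rw [Nat.cast_zero, sub_zero, complKernel_self hp1, kRes_flat hp0 hp1, sub_self]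
  | succ k ih =>
    intro x
    have h := complKernel_label_left hp0 hp1 (n := n - k) (t := 0) (N := N)
      (v := ((n, 0), -2 * n)) hn (by simp only; omega)
      (fun _ => Or.inr ⟨by simp, le_rfl⟩) x
    rw [Nat.cast_succ, ← sub_sub, h, if_neg, ih]
    · simp only [ih]
      simp
    · intro h
      simp only [Prod.mk.injEq] at h
      omega

/-- Let `n` be the largest label whose constraint fails. The column at `-2 n` is zero: in rows of
label at most `n` by `complKernel_flat_eq_zero`; in rows of label `n' > n` there is no `φ`, and `x <
-2 n'` makes `K̃` vanish. -/
theorem gapDet_initial_of_lt (hN : ∀ c ∈ S, c.1 ≤ N) (hS : ∀ c ∈ S, c.2 = 0)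
    (ha : ∃ c ∈ S, -2 * c.1 < a c) : gapDet p N S a = 0 := by
  obtain ⟨c, hc, hmax⟩ := (S.filter fun c => -2 * c.1 < a c).exists_max_image (fun c => c.1)
    (by
      obtain ⟨c, hc, hc'⟩ := ha
      exact ⟨c, Finset.mem_filter.2 ⟨hc, hc'⟩⟩)
  rw [Finset.mem_filter] at hc
  obtain ⟨n, t⟩ := c
  obtain ⟨hc, hac⟩ := hc
  have ht : t = 0 := hS _ hc
  have hnN : n ≤ N := hN _ hc
  subst ht
  have hv : ((n, 0), -2 * n) ∈ window N S a :=
    mem_window.2 ⟨hc, by simp only; omega, hac⟩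
  rw [gapDet, minorDet]
  refine Matrix.det_eq_zero_of_column_eq_zero ⟨_, hv⟩ ?_
  rintro ⟨⟨⟨n', t'⟩, x⟩, hu⟩
  rw [mem_window] at hu
  have ht : t' = 0 := hS _ hu.1
  subst ht
  rw [Matrix.of_apply]
  rcases le_or_gt n' n with h | h
  · have := complKernel_flat_eq_zero hp0 hp1 (N := N) hnN (n - n').toNat x
    rwa [Int.toNat_of_nonneg (by omega), sub_sub_cancel] at this
  · have hle : a (n', 0) ≤ -2 * n' := by
      by_contra hcon
      have := hmax (n', 0) (Finset.mem_filter.2 ⟨hu.1, not_le.1 hcon⟩)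
      simp only at this
      omega
    have hx := hu.2.2
    simp only at hx
    rw [complKernel, kRes_eq_zero hp0 hp1 (by simp only; omega), if_neg, sub_zero]
    rintro ⟨h1, -⟩
    simp only at h1
    omega

end

/-! ### The process as a function of the coins -/

section
variable {Ω : Type*}

/-- The positions in the parallel TASEP as a function of the coins, where particle `i` only looks
at particle `i - 1`. -/
def tasepPos (ξ : ℤ × ℕ → Ω → Bool) : ℕ → ℤ → Ω → ℤ
  | 0, i, _ => -2 * i
  | t + 1, i, ω => if ξ (i, t) ω = true ∧ tasepPos ξ t (i - 1) ω ≠ tasepPos ξ t i ω + 1 then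
      tasepPos ξ t i ω + 1 else tasepPos ξ t i ω

variable (ξ : ℤ × ℕ → Ω → Bool)

theorem tasepPos_succ (t : ℕ) (i : ℤ) (ω : Ω) : tasepPos ξ (t + 1) i ω =
    if ξ (i, t) ω = true ∧ tasepPos ξ t (i - 1) ω ≠ tasepPos ξ t i ω + 1 then
      tasepPos ξ t i ω + 1 else tasepPos ξ t i ω := rfl

theorem tasepPos_lt (t : ℕ) (ω : Ω) : ∀ i, tasepPos ξ t i ω < tasepPos ξ t (i - 1) ω := by
  induction t with
  | zero =>
    intro i
    simp only [tasepPos]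
    omega
  | succ t ih =>
    intro i
    have h := ih i
    rw [tasepPos_succ, tasepPos_succ]
    split_ifs <;> omega

theorem tasepPos_strictAnti (t : ℕ) (ω : Ω) : StrictAnti fun i => tasepPos ξ t i ω := by
  refine strictAnti_int_of_succ_lt fun i => ?_
  simpa using tasepPos_lt ξ t ω (i + 1)

theorem neg_two_mul_le_tasepPos (t : ℕ) (i : ℤ) (ω : Ω) : -2 * i ≤ tasepPos ξ t i ω := by
  induction t with
  | zero => exact le_rfl
  | succ t ih =>
    rw [tasepPos_succ]
    split_ifs <;> omega

/-- The order of the particles is strict, so the nearest particle ahead of `i` is `i - 1`. -/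
theorem site_empty_iff (t : ℕ) (i : ℤ) (ω : Ω) :
    (∀ j, tasepPos ξ t j ω ≠ tasepPos ξ t i ω + 1) ↔
      tasepPos ξ t (i - 1) ω ≠ tasepPos ξ t i ω + 1 := by
  refine ⟨fun h => h _, fun h j hj => ?_⟩
  have hlt := tasepPos_lt ξ t ω i
  have h1 : j < i := by
    rw [← (tasepPos_strictAnti ξ t ω).lt_iff_gt]
    omega
  have h2 : tasepPos ξ t (i - 1) ω ≤ tasepPos ξ t j ω :=
    (tasepPos_strictAnti ξ t ω).antitone (by omega)
  omega

theorem eq_tasepPos {ω : Ω} {x : ℤ → ℕ → Ω → ℤ} (h0 : ∀ i, x i 0 ω = -2 * i)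
    (h : ∀ i t,
        ((ξ (i, t) ω = true ∧ ∀ j, x j t ω ≠ x i t ω + 1) → x i (t + 1) ω = x i t ω + 1) ∧
        (¬ (ξ (i, t) ω = true ∧ ∀ j, x j t ω ≠ x i t ω + 1) → x i (t + 1) ω = x i t ω)) (t : ℕ) :
    ∀ i, x i t ω = tasepPos ξ t i ω := by
  induction t with
  | zero => exact h0
  | succ t ih =>
    intro i
    obtain ⟨h1, h2⟩ := h i t
    simp only [ih, site_empty_iff] at h1 h2
    rw [tasepPos_succ]
    split_ifs with hc
    · exact h1 hc
    · exact h2 hc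

/-- The σ-algebra generated by the coins `ξ e`, `e ∈ T`. -/
abbrev coinAlgebra (T : Set (ℤ × ℕ)) : MeasurableSpace Ω :=
  ⨆ e ∈ T, MeasurableSpace.comap (ξ e) ⊤

/-- The light cone of a particle; it yields the independence of the coin `(n, t)` from the other
constraints in `measureReal_flip`. -/
theorem measurable_tasepPos {T : Set (ℤ × ℕ)} (t : ℕ) :
    ∀ i, (∀ j s, j ≤ i → s < t → (j, s) ∈ T) →
      Measurable[coinAlgebra ξ T] (tasepPos ξ t i) := by
  induction t with
  | zero =>
    intro i _
    exact @measurable_const _ _ _ (coinAlgebra ξ T) _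
  | succ t ih =>
    intro i hT
    let _ : MeasurableSpace Ω := coinAlgebra ξ T
    have h1 : Measurable (tasepPos ξ t i) := ih i fun j s hj hs => hT j s hj (by omega)
    have h2 : Measurable (tasepPos ξ t (i - 1)) :=
      ih (i - 1) fun j s hj hs => hT j s (by omega) (by omega)
    have h3 : Measurable (ξ (i, t)) := by
      have hle : MeasurableSpace.comap (ξ (i, t)) ⊤ ≤ coinAlgebra ξ T :=
        le_iSup₂_of_le (i, t) (hT i t le_rfl (Nat.lt_succ_self t)) le_rfl
      exact (comap_measurable (ξ (i, t))).mono hle le_rfl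
    have h4 : MeasurableSet {ω | ξ (i, t) ω = true ∧
        tasepPos ξ t (i - 1) ω ≠ tasepPos ξ t i ω + 1} :=
      (h3 (measurableSet_singleton true)).inter
        (measurableSet_eq_fun h2 (h1.add_const 1)).compl
    exact Measurable.ite h4 (h1.add_const 1) h1

/-- The event that each particle and time `c ∈ S` has position at least `a c`. -/
def tasepEvent (S : Finset (ℤ × ℕ)) (a : ℤ × ℕ → ℤ) : Set Ω :=
  {ω | ∀ c ∈ S, a c ≤ tasepPos ξ c.2 c.1 ω}

theorem measurableSet_tasepEvent {T : Set (ℤ × ℕ)} {S : Finset (ℤ × ℕ)} (a : ℤ × ℕ → ℤ)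
    (hS : ∀ c ∈ S, ∀ j s, j ≤ c.1 → s < c.2 → (j, s) ∈ T) :
    MeasurableSet[coinAlgebra ξ T] (tasepEvent ξ S a) := by
  have : tasepEvent ξ S a = ⋂ c ∈ S, tasepPos ξ c.2 c.1 ⁻¹' Set.Ici (a c) := by
    ext ω
    simp [tasepEvent]
  rw [this]
  refine @Finset.measurableSet_biInter _ _ (coinAlgebra ξ T) _ S fun c hc => ?_
  exact measurable_tasepPos ξ c.2 c.1 (hS c hc) measurableSet_Ici

theorem tasepEvent_congr {S : Finset (ℤ × ℕ)} {a a' : ℤ × ℕ → ℤ} (h : ∀ c ∈ S, a c = a' c) :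
    tasepEvent ξ S a = tasepEvent ξ S a' := by
  ext ω
  exact forall₂_congr fun c hc => by rw [h c hc]

theorem tasepEvent_insert (c : ℤ × ℕ) (S : Finset (ℤ × ℕ)) (a : ℤ × ℕ → ℤ) :
    tasepEvent ξ (insert c S) a = {ω | a c ≤ tasepPos ξ c.2 c.1 ω} ∩ tasepEvent ξ S a := by
  ext ω
  simp [tasepEvent]

theorem tasepEvent_insert_of_imp {c : ℤ × ℕ} {S : Finset (ℤ × ℕ)} {a : ℤ × ℕ → ℤ}
    (h : ∀ ω, (∀ c ∈ S, a c ≤ tasepPos ξ c.2 c.1 ω) → a c ≤ tasepPos ξ c.2 c.1 ω) :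
    tasepEvent ξ (insert c S) a = tasepEvent ξ S a := by
  rw [tasepEvent_insert, Set.inter_eq_right]
  exact fun ω hω => h ω hω

theorem le_tasepPos_succ (t : ℕ) (i : ℤ) (ω : Ω) :
    tasepPos ξ t i ω ≤ tasepPos ξ (t + 1) i ω := by
  rw [tasepPos_succ]
  split_ifs <;> omega

theorem tasepPos_succ_le (t : ℕ) (i : ℤ) (ω : Ω) :
    tasepPos ξ (t + 1) i ω ≤ tasepPos ξ t i ω + 1 := by
  rw [tasepPos_succ]
  split_ifs <;> omega

variable [MeasurableSpace Ω] (P : Measure Ω) [IsProbabilityMeasure P]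

theorem coinAlgebra_le {ξ : ℤ × ℕ → Ω → Bool} (hm : ∀ e, Measurable (ξ e)) (T : Set (ℤ × ℕ)) :
    coinAlgebra ξ T ≤ ‹MeasurableSpace Ω› :=
  iSup₂_le fun e _ => (hm e).comap_le

variable {ξ P}

omit [IsProbabilityMeasure P] in
theorem measureReal_inter_coin {p : ℝ} (hm : ∀ e, Measurable (ξ e)) (hi : iIndepFun ξ P)
    (hp : ∀ e, P.real {ω | ξ e ω = true} = p) (e : ℤ × ℕ) {E : Set Ω}
    (hE : MeasurableSet[coinAlgebra ξ {e}ᶜ] E) :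
    P.real (E ∩ {ω | ξ e ω = true}) = p * P.real E := by
  have h := indep_iSup_of_disjoint (fun e => (hm e).comap_le) hi
    (show Disjoint ({e}ᶜ : Set (ℤ × ℕ)) {e} from disjoint_compl_left)
  have h1 : MeasurableSet[⨆ i ∈ ({e} : Set (ℤ × ℕ)), MeasurableSpace.comap (ξ i) ⊤]
      {ω | ξ e ω = true} := by
    have h2 : MeasurableSpace.comap (ξ e) ⊤ ≤ coinAlgebra ξ {e} :=
      le_iSup₂_of_le e (Set.mem_singleton e) le_rfl
    exact h2 _ ⟨{true}, trivial, rfl⟩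
  have h2 := (Indep_iff _ _ _).1 h E _ hE h1
  rw [measureReal_def, h2, ENNReal.toReal_mul, ← measureReal_def, ← measureReal_def, hp, mul_comm]

theorem measureReal_flip {p : ℝ} (hm : ∀ e, Measurable (ξ e)) (hi : iIndepFun ξ P)
    (hp : ∀ e, P.real {ω | ξ e ω = true} = p) {n : ℤ} {t : ℕ} {R : Finset (ℤ × ℕ)}
    (hR : ∀ c ∈ R, FlipCompatible n t c) (a : ℤ × ℕ → ℤ) (b : ℤ) :
    P.real (tasepEvent ξ (insert (n, t + 1) R) (Function.update a (n, t + 1) b)) =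
      (1 - p) * P.real (tasepEvent ξ (insert (n, t) R) (Function.update a (n, t) b)) +
      p * P.real (tasepEvent ξ (insert (n - 1, t) (insert (n, t) R))
        (Function.update (Function.update a (n - 1, t) (b + 1)) (n, t) (b - 1))) := by
  have hne2 : ((n - 1, t) : ℤ × ℕ) ≠ (n, t) := by simp
  have hRne : ∀ c ∈ R, c ≠ (n, t) ∧ c ≠ (n, t + 1) ∧ c ≠ (n - 1, t) := fun c hc => (hR c hc).ne
  set E := tasepEvent ξ R a with hE
  set W : ℤ → Set Ω := fun k => {ω | k ≤ tasepPos ξ t n ω} with hW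
  set V : Set Ω := {ω | b + 1 ≤ tasepPos ξ t (n - 1) ω} with hV
  have e1 : tasepEvent ξ (insert (n, t) R) (Function.update a (n, t) b) = W b ∩ E := by
    rw [tasepEvent_insert, Function.update_self, tasepEvent_congr ξ (a' := a)]
    exact fun c hc => Function.update_of_ne (hRne c hc).1 _ _
  have e2 : tasepEvent ξ (insert (n - 1, t) (insert (n, t) R))
        (Function.update (Function.update a (n - 1, t) (b + 1)) (n, t) (b - 1)) =
      V ∩ (W (b - 1) ∩ E) := by
    rw [tasepEvent_insert, tasepEvent_insert, Function.update_self,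
      Function.update_of_ne hne2, Function.update_self, tasepEvent_congr ξ (a' := a)]
    intro c hc
    rw [Function.update_of_ne (hRne c hc).1, Function.update_of_ne (hRne c hc).2.2]
  -- Outside of `W b`, particle `n` must stand at `b - 1` and jump; site `b` is then empty exactly
  -- on `V`, as particle `n - 1` is strictly ahead.
  have e3 : tasepEvent ξ (insert (n, t + 1) R) (Function.update a (n, t + 1) b) =
      (W b ∩ E) ∪ ((V ∩ (W (b - 1) ∩ E)) \ (W b ∩ E)) ∩ {ω | ξ (n, t) ω = true} := by
    rw [tasepEvent_insert, Function.update_self, tasepEvent_congr ξ (a' := a)]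
    · ext ω
      have hlt := tasepPos_lt ξ t ω n
      simp only [Set.mem_inter_iff, Set.mem_union, Set.mem_sdiff, Set.mem_ofPred_eq, hW, hV, ← hE,
        tasepPos_succ]
      by_cases hEω : ω ∈ E
      · simp only [hEω, and_true]
        by_cases hξ : ξ (n, t) ω = true
        · simp only [hξ, true_and, and_true]
          split_ifs <;> omega
        · simp [hξ]
      · simp [hEω]
    · exact fun c hc => Function.update_of_ne (hRne c hc).2.1 _ _
  have hsub : W b ∩ E ⊆ V ∩ (W (b - 1) ∩ E) := by
    rintro ω ⟨h1, h2⟩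
    have hlt := tasepPos_lt ξ t ω n
    simp only [hW, Set.mem_ofPred_eq] at h1
    refine ⟨?_, ?_, h2⟩
    · simp only [hV, Set.mem_ofPred_eq]
      omega
    · simp only [hW, Set.mem_ofPred_eq]
      omega
  -- Points of `R` with label below `n` never read a coin of particle `n`; the others have time at
  -- most `t` and read only coins flipped before `t`.
  have hEm : MeasurableSet[coinAlgebra ξ {(n, t)}ᶜ] E := by
    refine measurableSet_tasepEvent ξ a fun c hc j s hj hs => ?_
    have := hR c hc
    obtain ⟨m, k⟩ := c
    simp only [FlipCompatible] at this hj hs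
    simp only [Set.mem_compl_iff, Set.mem_singleton_iff, Prod.mk.injEq]
    omega
  have hWm : ∀ k, MeasurableSet[coinAlgebra ξ {(n, t)}ᶜ] (W k) := fun k => by
    refine measurable_tasepPos ξ t n (fun j s hj hs => ?_) measurableSet_Ici
    simp only [Set.mem_compl_iff, Set.mem_singleton_iff, Prod.mk.injEq]
    omega
  have hVm : MeasurableSet[coinAlgebra ξ {(n, t)}ᶜ] V := by
    refine measurable_tasepPos ξ t (n - 1) (fun j s hj hs => ?_) measurableSet_Ici
    simp only [Set.mem_compl_iff, Set.mem_singleton_iff, Prod.mk.injEq]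
    omega
  have hWE := @MeasurableSet.inter _ (coinAlgebra ξ {(n, t)}ᶜ) _ _ (hWm b) hEm
  have hVWE := @MeasurableSet.inter _ (coinAlgebra ξ {(n, t)}ᶜ) _ _ hVm
    (@MeasurableSet.inter _ (coinAlgebra ξ {(n, t)}ᶜ) _ _ (hWm (b - 1)) hEm)
  have hdiff := @MeasurableSet.diff _ (coinAlgebra ξ {(n, t)}ᶜ) _ _ hVWE hWE
  have hle := coinAlgebra_le hm {(n, t)}ᶜ
  have hcoin : MeasurableSet {ω | ξ (n, t) ω = true} := hm (n, t) (measurableSet_singleton true)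
  rw [e1, e2, e3, measureReal_union (Set.disjoint_sdiff_right.mono_right Set.inter_subset_left)
    ((hle _ hdiff).inter hcoin), measureReal_inter_coin hm hi hp _ hdiff,
    measureReal_sdiff hsub (hle _ hWE)]
  ring

end

/-! ### Induction over space-like chains -/

/-- Any two elements of `S` are comparable in the space-like order. -/
def IsSpaceLikeChain (S : Finset (ℤ × ℕ)) : Prop :=
  ∀ c ∈ S, ∀ c' ∈ S, SpaceLikeLE c c' ∨ SpaceLikeLE c' c

theorem IsSpaceLikeChain.subset {S T : Finset (ℤ × ℕ)} (hS : IsSpaceLikeChain S) (h : T ⊆ S) :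
    IsSpaceLikeChain T := fun c hc c' hc' => hS c (h hc) c' (h hc')

theorem IsSpaceLikeChain.insert {S : Finset (ℤ × ℕ)} {c : ℤ × ℕ} (hS : IsSpaceLikeChain S)
    (h : ∀ c' ∈ S, SpaceLikeLE c c' ∨ SpaceLikeLE c' c) : IsSpaceLikeChain (insert c S) := by
  intro d hd d' hd'
  rcases Finset.mem_insert.1 hd with rfl | hd1
  · rcases Finset.mem_insert.1 hd' with rfl | hd2
    · exact Or.inl ⟨le_rfl, le_rfl⟩
    · exact h d' hd2
  · rcases Finset.mem_insert.1 hd' with rfl | hd2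
    · exact (h d hd1).symm
    · exact hS d hd1 d' hd2

theorem FlipCompatible.comparable {n : ℤ} {t : ℕ} {c : ℤ × ℕ} (h : FlipCompatible n t c) :
    (SpaceLikeLE (n, t) c ∨ SpaceLikeLE c (n, t)) ∧
      (SpaceLikeLE (n - 1, t) c ∨ SpaceLikeLE c (n - 1, t)) := by
  obtain ⟨m, s⟩ := c
  simp only [FlipCompatible, SpaceLikeLE, Prod.mk.injEq, ne_eq] at h ⊢
  omega

/-- A space-like chain with a nonzero time has a last point among those of maximal time. -/
theorem IsSpaceLikeChain.exists_flip {S : Finset (ℤ × ℕ)} (hS : IsSpaceLikeChain S)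
    (h : ∃ c ∈ S, c.2 ≠ 0) :
    ∃ n t, (n, t + 1) ∈ S ∧
      ∀ c ∈ (S.erase (n, t + 1)).erase (n, t), FlipCompatible n t c := by
  obtain ⟨c₀, hc₀, hc₀'⟩ := h
  obtain ⟨c₁, hc₁, hmax₁⟩ := S.exists_max_image (fun c => c.2) ⟨c₀, hc₀⟩
  obtain ⟨⟨n, t'⟩, hc, hmax⟩ := (S.filter fun c => c.2 = c₁.2).exists_max_image (fun c => c.1)
    ⟨c₁, Finset.mem_filter.2 ⟨hc₁, rfl⟩⟩
  rw [Finset.mem_filter] at hc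
  obtain ⟨hcS, hct⟩ := hc
  simp only at hct
  obtain ⟨t, rfl⟩ : ∃ t, t' = t + 1 := Nat.exists_eq_succ_of_ne_zero (by
    have := hmax₁ c₀ hc₀
    omega)
  refine ⟨n, t, hcS, fun c hc => ?_⟩
  simp only [Finset.mem_erase] at hc
  obtain ⟨hcw, hcw', hc⟩ := hc
  have h1 := hmax₁ c hc
  have h2 : c.2 = t + 1 → c.1 ≤ n := fun h => hmax c (Finset.mem_filter.2 ⟨hc, h.trans hct⟩)
  have h3 := hS c hc _ hcS
  obtain ⟨m, s⟩ := c
  simp only [FlipCompatible, SpaceLikeLE, Prod.mk.injEq, ne_eq] at *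
  omega

section
variable {Ω : Type*} {ξ : ℤ × ℕ → Ω → Bool} [MeasurableSpace Ω] {P : Measure Ω}
  [IsProbabilityMeasure P] {p : ℝ} {N : ℤ}

theorem gapDet_initial (hp0 : 0 < p) (hp1 : p < 1) {S : Finset (ℤ × ℕ)} (a : ℤ × ℕ → ℤ)
    (hN : ∀ c ∈ S, c.1 ≤ N) (hS : ∀ c ∈ S, c.2 = 0) :
    gapDet p N S a = P.real (tasepEvent ξ S a) := by
  have hX : ∀ c ∈ S, ∀ ω, tasepPos ξ c.2 c.1 ω = -2 * c.1 := fun c hc ω => by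
    rw [hS c hc]
    rfl
  by_cases ha : ∀ c ∈ S, a c ≤ -2 * c.1
  · rw [gapDet_initial_of_le hp0 hp1 hS ha]
    have : tasepEvent ξ S a = Set.univ :=
      Set.eq_univ_of_forall fun ω c hc => by rw [hX c hc]; exact ha c hc
    rw [this, probReal_univ, Complex.ofReal_one]
  · push Not at ha
    rw [gapDet_initial_of_lt hp0 hp1 hN hS ha]
    obtain ⟨c, hc, hac⟩ := ha
    have : tasepEvent ξ S a = ∅ := Set.eq_empty_of_forall_notMem fun ω hω => by
      have := hω c hc
      rw [hX c hc] at this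
      omega
    rw [this, measureReal_empty, Complex.ofReal_zero]

/-- The weight `∑ 3 ^ time` decreases because a point at `(n, t + 1)`, of weight `3 * 3 ^ t`, is
replaced by at most two points of weight `3 ^ t`. -/
theorem gapDet_eq_measureReal (hp0 : 0 < p) (hp1 : p < 1) (hm : ∀ e, Measurable (ξ e))
    (hi : iIndepFun ξ P) (hp : ∀ e, P.real {ω | ξ e ω = true} = p) {S : Finset (ℤ × ℕ)}
    (hS : IsSpaceLikeChain S) (hN : ∀ c ∈ S, c.1 ≤ N) (a : ℤ × ℕ → ℤ) :
    gapDet p N S a = P.real (tasepEvent ξ S a) := by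
  induction hk : ∑ c ∈ S, 3 ^ c.2 using Nat.strong_induction_on generalizing S a with
  | _ k ih =>
  subst hk
  by_cases h0 : ∀ c ∈ S, c.2 = 0
  · exact gapDet_initial hp0 hp1 a hN h0
  push Not at h0
  obtain ⟨n, t, hw', hR⟩ := hS.exists_flip h0
  set R := (S.erase (n, t + 1)).erase (n, t) with hRdef
  have hRS : R ⊆ S := (Finset.erase_subset _ _).trans (Finset.erase_subset _ _)
  have hn : n ≤ N := hN _ hw'
  have hRN : ∀ c ∈ R, c.1 ≤ N ∧ FlipCompatible n t c := fun c hc => ⟨hN c (hRS hc), hR c hc⟩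
  have hw'R : (n, t + 1) ∉ R := fun h => (hR _ h).ne.2.1 rfl
  have hwR : (n, t) ∉ R := fun h => (hR _ h).ne.1 rfl
  have hvR : (n - 1, t) ∉ R := fun h => (hR _ h).ne.2.2 rfl
  have hne : ((n, t + 1) : ℤ × ℕ) ≠ (n, t) := by simp
  have hsum : 3 ^ (t + 1) + ∑ c ∈ R, 3 ^ c.2 ≤ ∑ c ∈ S, 3 ^ c.2 := by
    have : insert (n, t + 1) R ⊆ S := Finset.insert_subset hw' hRS
    calc 3 ^ (t + 1) + ∑ c ∈ R, 3 ^ c.2 = ∑ c ∈ insert (n, t + 1) R, 3 ^ c.2 := by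
          rw [Finset.sum_insert hw'R]
      _ ≤ _ := Finset.sum_le_sum_of_subset this
  have hpos : 0 < 3 ^ t := by positivity
  rw [pow_succ] at hsum
  have hchainR := hS.subset hRS
  have hchainW : IsSpaceLikeChain (insert (n, t) R) :=
    hchainR.insert fun c hc => (hR c hc).comparable.1
  have ihR : ∀ a, gapDet p N R a = P.real (tasepEvent ξ R a) := fun a =>
    ih _ (by omega) hchainR (fun c hc => (hRN c hc).1) a rfl
  have ihW : ∀ a, gapDet p N (insert (n, t) R) a = P.real (tasepEvent ξ (insert (n, t) R) a) := by
    intro a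
    refine ih _ ?_ hchainW ?_ a rfl
    · rw [Finset.sum_insert hwR]
      simp only
      omega
    · intro c hc
      rcases Finset.mem_insert.1 hc with rfl | hc
      · exact hn
      · exact (hRN c hc).1
  have ihV : ∀ a, gapDet p N (insert (n - 1, t) (insert (n, t) R)) a =
      P.real (tasepEvent ξ (insert (n - 1, t) (insert (n, t) R)) a) := by
    intro a
    refine ih _ ?_ (hchainW.insert fun c hc => ?_) ?_ a rfl
    · rw [Finset.sum_insert (by simp [hvR]), Finset.sum_insert hwR]
      simp only
      omega
    · rcases Finset.mem_insert.1 hc with rfl | hc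
      · exact Or.inl ⟨by simp, le_rfl⟩
      · exact (hR c hc).comparable.2
    · intro c hc
      rcases Finset.mem_insert.1 hc with rfl | hc
      · simp only
        omega
      rcases Finset.mem_insert.1 hc with rfl | hc
      · exact hn
      · exact (hRN c hc).1
  have main : gapDet p N (insert (n, t + 1) R) a =
      P.real (tasepEvent ξ (insert (n, t + 1) R) a) := by
    -- In the first case the window at `(n, t + 1)` is empty and the constraint is certain, since
    -- the particle never goes below `-2 n ≥ -N - n`.
    rcases le_or_gt (a (n, t + 1)) (-N - n) with hb | hb
    · rw [tasepEvent_insert_of_imp, ← ihR, gapDet, gapDet]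
      · congr 1
        ext u
        simp only [mem_window, Finset.mem_insert]
        constructor
        · rintro ⟨h | h, h1, h2⟩
          · rw [h] at h1 h2
            simp only at h1
            omega
          · exact ⟨h, h1, h2⟩
        · exact fun h => ⟨Or.inr h.1, h.2⟩
      · intro ω _
        have := neg_two_mul_le_tasepPos ξ (t + 1) n ω
        simp only
        omega
    · have hupd : Function.update a (n, t + 1) (a (n, t + 1)) = a := Function.update_eq_self _ _
      have hflip := gapDet_flip hp0 hp1 hRN hn a hb
      have hflip' := measureReal_flip (P := P) hm hi hp hR a (a (n, t + 1))
      rw [gapDet_insert_vacuous hp0 hp1 hRN, hupd, ihW, ihV,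
        gapDet_congr (a' := a)] at hflip
      · rw [hflip, ← hupd, hflip', hupd]
        push_cast
        ring
      · intro c hc
        refine Function.update_of_ne ?_ _ _
        rintro rfl
        rcases Finset.mem_insert.1 hc with h | h
        · exact hne h.symm
        · exact hwR h
      · rw [Function.update_self, Function.update_of_ne hne, Function.update_self]
        omega
  -- When both `(n, t)` and `(n, t + 1)` are present, one of the two constraints implies the other.
  by_cases hwS : (n, t) ∈ S
  · have hSeq : S = insert (n, t + 1) (insert (n, t) R) := by
      rw [hRdef, Finset.insert_erase (Finset.mem_erase.2 ⟨hne.symm, hwS⟩), Finset.insert_erase hw']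
    rw [hSeq]
    rcases le_or_gt (a (n, t + 1)) (a (n, t)) with hab | hab
    · rw [gapDet_insert_time hp0 hp1 hRN hn hab, ihW,
        tasepEvent_insert_of_imp ξ (c := (n, t + 1))]
      intro ω hω
      have h1 := hω _ (Finset.mem_insert_self _ _)
      have h2 := le_tasepPos_succ ξ t n ω
      simp only at h1 ⊢
      omega
    · rw [Finset.insert_comm, gapDet_insert_vacuous hp0 hp1 hRN hab, main,
        tasepEvent_insert_of_imp ξ (c := (n, t))]
      intro ω hω
      have h1 := hω _ (Finset.mem_insert_self _ _)
      have h2 := tasepPos_succ_le ξ t n ω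
      simp only at h1 ⊢
      omega
  · have hSeq : S = insert (n, t + 1) R := by
      rw [hRdef, Finset.erase_eq_of_notMem (fun h => hwS (Finset.mem_of_mem_erase h)),
        Finset.insert_erase hw']
    rw [hSeq, main]

end

/-! ### Contour integrals and winding numbers -/

/-- A function of three integers which satisfies the linear relations between the functions
`z ^ i * (1 + z) ^ j * (1 + p * z) ^ k` and vanishes if two of the exponents do, vanishes. -/
theorem eq_zero_of_ratFun_relations {p : ℂ} (hp0 : p ≠ 0) (hp1 : p ≠ 1) {A₀ A₁ A₂ : Prop}
    {d : ℤ → ℤ → ℤ → ℂ}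
    (hj : ∀ i j k, (i < 0 → A₀) → (j < 0 → A₁) → (k < 0 → A₂) →
      d i (j + 1) k = d (i + 1) j k + d i j k)
    (hk : ∀ i j k, (i < 0 → A₀) → (j < 0 → A₁) → (k < 0 → A₂) →
      d i j (k + 1) = p * d (i + 1) j k + d i j k)
    (h₀ : ∀ i, (i < 0 → A₀) → d i 0 0 = 0) (h₁ : ∀ j, (j < 0 → A₁) → d 0 j 0 = 0)
    (h₂ : ∀ k, (k < 0 → A₂) → d 0 0 k = 0) (i j k : ℤ)
    (hi' : i < 0 → A₀) (hj' : j < 0 → A₁) (hk' : k < 0 → A₂) : d i j k = 0 := by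
  -- `A₀`, `A₁`, `A₂` stand for what is known of the contour at `0`, `-1`, `-1/p`, available only
  -- where the exponent is negative. Each relation raises exponents from `(i, j, k)`, so it asks for
  -- nothing new at the other terms.
  have nn : ∀ (n : ℕ) {A : Prop}, (n : ℤ) < 0 → A := fun n A h => absurd h (by omega)
  have n0 : ∀ {A : Prop}, (0 : ℤ) < 0 → A := fun h => absurd h (lt_irrefl _)
  have up : ∀ {n : ℤ} {A : Prop}, (n < 0 → A) → n + 1 < 0 → A := fun h h' => h (by omega)
  have posI : ∀ (k j : ℕ) (i : ℤ), (i < 0 → A₀) → d i j k = 0 := by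
    intro k
    induction k with
    | zero =>
      intro j
      induction j with
      | zero => exact h₀
      | succ j ih =>
        intro i hi
        rw [Nat.cast_succ, hj _ _ _ hi (nn j) (nn 0), ih _ (up hi), ih _ hi, add_zero]
    | succ k ih =>
      intro j i hi
      rw [Nat.cast_succ, hk _ _ _ hi (nn j) (nn k), ih j _ (up hi), ih j _ hi, mul_zero, add_zero]
  have posJ : ∀ (k i : ℕ) (j : ℤ), (j < 0 → A₁) → d i j k = 0 := by
    intro k
    induction k with
    | zero =>
      intro i
      induction i with
      | zero => exact h₁
      | succ i ih =>
        intro j h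
        have h3 := hj i j 0 (nn i) h n0
        rw [Nat.cast_zero] at ih
        rw [ih _ (up h), ih _ h, add_zero] at h3
        rw [Nat.cast_succ, Nat.cast_zero, ← h3]
    | succ k ih =>
      intro i j h
      have h3 := ih (i + 1) j h
      rw [Nat.cast_succ] at h3
      rw [Nat.cast_succ, hk _ _ _ (nn i) h (nn k), h3, ih i _ h, mul_zero, add_zero]
  have posK : ∀ (j i : ℕ) (k : ℤ), (k < 0 → A₂) → d i j k = 0 := by
    intro j
    induction j with
    | zero =>
      intro i
      induction i with
      | zero => exact h₂
      | succ i ih =>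
        intro k h
        have h3 := hk i 0 k (nn i) n0 h
        rw [Nat.cast_zero] at ih
        rw [ih _ (up h), ih _ h, add_zero] at h3
        rw [Nat.cast_succ, Nat.cast_zero]
        exact (mul_eq_zero.1 h3.symm).resolve_left hp0
    | succ j ih =>
      intro i k h
      have h3 := ih (i + 1) k h
      rw [Nat.cast_succ] at h3
      rw [Nat.cast_succ, hj _ _ _ (nn i) (nn j) h, h3, ih i _ h, add_zero]
  -- Partial fractions: with two negative exponents, a relation reduces the total of the negative
  -- parts. A single negative exponent is covered by `posI`, `posJ` and `posK`.
  induction hM : (-i).toNat + (-j).toNat + (-k).toNat using Nat.strong_induction_on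
    generalizing i j k with
  | _ M ih =>
  subst hM
  rcases lt_or_ge i 0 with hi | hi
  · rcases lt_or_ge j 0 with hj0 | hj0
    · have h := hj i j k hi' hj' hk'
      rw [ih _ (by omega) i (j + 1) k hi' (up hj') hk' rfl,
        ih _ (by omega) (i + 1) j k (up hi') hj' hk' rfl, zero_add] at h
      exact h.symm
    · rcases lt_or_ge k 0 with hk0 | hk0
      · have h := hk i j k hi' hj' hk'
        rw [ih _ (by omega) i j (k + 1) hi' hj' (up hk') rfl,
          ih _ (by omega) (i + 1) j k (up hi') hj' hk' rfl, mul_zero, zero_add] at h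
        exact h.symm
      · lift j to ℕ using hj0
        lift k to ℕ using hk0
        exact posI k j i hi'
  · lift i to ℕ using hi
    rcases lt_or_ge j 0 with hj0 | hj0
    · rcases lt_or_ge k 0 with hk0 | hk0
      · have h := hk i j k hi' hj' hk'
        have h3 := hj i j k hi' hj' hk'
        rw [ih _ (by omega) i (j + 1) k hi' (up hj') hk' rfl] at h3
        rw [ih _ (by omega) i j (k + 1) hi' hj' (up hk') rfl] at h
        -- The combination `(1 + p z) - p (1 + z) = 1 - p` eliminates the term with `i + 1`.
        have h4 : (1 - p) * d i j k = 0 := by linear_combination p * h3 - h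
        exact (mul_eq_zero.1 h4).resolve_left (sub_ne_zero.2 hp1.symm)
      · lift k to ℕ using hk0
        exact posJ k i j hj'
    · lift j to ℕ using hj0
      exact posK j i k hk'

section
variable {γ : ℝ → ℂ} (hγ : IsSimpleLoop γ)
include hγ

theorem IsSimpleLoop.intervalIntegrable_mul_deriv {f : ℂ → ℂ}
    (hf : ∀ s ∈ Set.Icc (0 : ℝ) 1, ContinuousAt f (γ s)) :
    IntervalIntegrable (fun s => f (γ s) * deriv γ s) volume 0 1 := by
  refine hγ.rectifiable.continuousOn_mul ?_
  rw [Set.uIcc_of_le zero_le_one]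
  exact fun s hs => (hf s hs).comp_continuousWithinAt (hγ.continuousOn s hs)

theorem IsSimpleLoop.loopIntegral_eq_zero {f F : ℂ → ℂ}
    (hf : ∀ s ∈ Set.Icc (0 : ℝ) 1, ContinuousAt f (γ s))
    (hF : ∀ s ∈ Set.Icc (0 : ℝ) 1, HasDerivAt F (f (γ s)) (γ s)) : loopIntegral f γ = 0 := by
  obtain ⟨s, hs, hd⟩ := hγ.piecewise_C1
  have h := integral_eq_of_hasDerivAt_off_countable_of_le (fun t => F (γ t))
    (fun t => f (γ t) * deriv γ t) zero_le_one hs.countable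
    (fun t ht => (hF t ht).continuousAt.comp_continuousWithinAt (hγ.continuousOn t ht))
    (fun t ht => by
      have h1 := (hF t (Set.Ioo_subset_Icc_self ht.1)).scomp t (hd t ht).1.hasDerivAt
      rw [smul_eq_mul, mul_comm] at h1
      exact h1)
    (hγ.intervalIntegrable_mul_deriv hf)
  rw [loopIntegral, h, hγ.closed, sub_self]

/-- Every power other than `-1` has a primitive along the loop. -/
theorem IsSimpleLoop.loopIntegral_sub_zpow {b : ℂ} {n : ℤ}
    (hb : n < 0 → ∀ s ∈ Set.Icc (0 : ℝ) 1, γ s ≠ b) :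
    (2 * Real.pi * Complex.I)⁻¹ * loopIntegral (fun z => (z - b) ^ n) γ =
      if n = -1 then windingNumber γ b else 0 := by
  split_ifs with h
  · subst h
    simp only [zpow_neg_one]
    rfl
  · have cond : ∀ s ∈ Set.Icc (0 : ℝ) 1, ∀ m : ℤ, (m < 0 → n < 0) → γ s - b ≠ 0 ∨ 0 ≤ m := by
      intro s hs m hm
      rcases lt_or_ge m 0 with h' | h'
      · exact Or.inl (sub_ne_zero.2 (hb (hm h') s hs))
      · exact Or.inr h'
    have hn : ((n + 1 : ℤ) : ℂ) ≠ 0 := by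
      rw [Int.cast_ne_zero]
      omega
    rw [hγ.loopIntegral_eq_zero (F := fun z => (z - b) ^ (n + 1) / ((n + 1 : ℤ) : ℂ)), mul_zero]
    · intro s hs
      exact (continuousAt_id.sub continuousAt_const).zpow₀ n (cond s hs n id)
    · intro s hs
      have h1 := (hasDerivAt_zpow (n + 1) (γ s - b) (cond s hs (n + 1) fun h => by omega)).comp
        (γ s) ((hasDerivAt_id (γ s)).sub_const b)
      have h2 := h1.div_const ((n + 1 : ℤ) : ℂ)
      rw [mul_one, add_sub_cancel_right, mul_div_cancel_left₀ _ hn] at h2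
      exact h2

variable {p : ℝ}

theorem IsSimpleLoop.loopIntegral_ratFun_succ_j {i j k : ℤ}
    (hi : i < 0 → ∀ s ∈ Set.Icc (0 : ℝ) 1, γ s ≠ 0)
    (hj : j < 0 → ∀ s ∈ Set.Icc (0 : ℝ) 1, 1 + γ s ≠ 0)
    (hk : k < 0 → ∀ s ∈ Set.Icc (0 : ℝ) 1, 1 + (p : ℂ) * γ s ≠ 0) :
    loopIntegral (ratFun p i (j + 1) k) γ =
      loopIntegral (ratFun p (i + 1) j k) γ + loopIntegral (ratFun p i j k) γ := by
  simp only [loopIntegral]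
  rw [← intervalIntegral.integral_add]
  · refine intervalIntegral.integral_congr fun s hs => ?_
    rw [Set.uIcc_of_le zero_le_one] at hs
    rw [ratFun_succ_j (fun h => hi h s hs) (fun h => hj h s hs), add_mul]
  · exact hγ.intervalIntegrable_mul_deriv fun s hs => continuousAt_ratFun
      (fun h => hi (by omega) s hs) (fun h => hj h s hs) (fun h => hk h s hs)
  · exact hγ.intervalIntegrable_mul_deriv fun s hs => continuousAt_ratFun
      (fun h => hi h s hs) (fun h => hj h s hs) (fun h => hk h s hs)

theorem IsSimpleLoop.loopIntegral_ratFun_succ_k {i j k : ℤ}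
    (hi : i < 0 → ∀ s ∈ Set.Icc (0 : ℝ) 1, γ s ≠ 0)
    (hj : j < 0 → ∀ s ∈ Set.Icc (0 : ℝ) 1, 1 + γ s ≠ 0)
    (hk : k < 0 → ∀ s ∈ Set.Icc (0 : ℝ) 1, 1 + (p : ℂ) * γ s ≠ 0) :
    loopIntegral (ratFun p i j (k + 1)) γ =
      p * loopIntegral (ratFun p (i + 1) j k) γ + loopIntegral (ratFun p i j k) γ := by
  simp only [loopIntegral]
  rw [← intervalIntegral.integral_const_mul, ← intervalIntegral.integral_add]
  · refine intervalIntegral.integral_congr fun s hs => ?_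
    rw [Set.uIcc_of_le zero_le_one] at hs
    rw [ratFun_succ_k (fun h => hi h s hs) (fun h => hk h s hs)]
    ring
  · exact (hγ.intervalIntegrable_mul_deriv fun s hs => continuousAt_ratFun
      (fun h => hi (by omega) s hs) (fun h => hj h s hs) (fun h => hk h s hs)).const_mul _
  · exact hγ.intervalIntegrable_mul_deriv fun s hs => continuousAt_ratFun
      (fun h => hi h s hs) (fun h => hj h s hs) (fun h => hk h s hs)

/-- The residue theorem for `ratFun`. -/
theorem IsSimpleLoop.loopIntegral_ratFun (hp0 : 0 < p) (hp1 : p < 1) {a : ℂ}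
    (ha : a = 0 ∨ a = -1) {i j k : ℤ}
    (hi : i < 0 → (∀ s ∈ Set.Icc (0 : ℝ) 1, γ s ≠ 0) ∧
      windingNumber γ 0 = if a = 0 then 1 else 0)
    (hj : j < 0 → (∀ s ∈ Set.Icc (0 : ℝ) 1, γ s ≠ -1) ∧
      windingNumber γ (-1) = if a = -1 then 1 else 0)
    (hk : k < 0 → (∀ s ∈ Set.Icc (0 : ℝ) 1, γ s ≠ -(p : ℂ)⁻¹) ∧
      windingNumber γ (-(p : ℂ)⁻¹) = 0) :
    (2 * Real.pi * Complex.I)⁻¹ * loopIntegral (ratFun p i j k) γ = circleRes p a i j k := by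
  have hp : (p : ℂ) ≠ 0 := Complex.ofReal_ne_zero.2 hp0.ne'
  have hne1 : ∀ z : ℂ, z ≠ -1 → 1 + z ≠ 0 := fun z hz h => hz (by linear_combination h)
  have hnep : ∀ z : ℂ, z ≠ -(p : ℂ)⁻¹ → 1 + (p : ℂ) * z ≠ 0 := fun z hz h => hz (by
    field_simp
    linear_combination h)
  rw [← sub_eq_zero]
  refine eq_zero_of_ratFun_relations (p := p) hp (by exact_mod_cast hp1.ne)
    (d := fun i j k => (2 * Real.pi * Complex.I)⁻¹ * loopIntegral (ratFun p i j k) γ -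
      circleRes p a i j k) ?_ ?_ ?_ ?_ ?_ i j k hi hj hk
  · intro i j k hi hj hk
    rw [hγ.loopIntegral_ratFun_succ_j (fun h => (hi h).1) (fun h s hs => hne1 _ ((hj h).1 s hs))
      (fun h s hs => hnep _ ((hk h).1 s hs)), circleRes_succ_j hp0 hp1 ha]
    ring
  · intro i j k hi hj hk
    rw [hγ.loopIntegral_ratFun_succ_k (fun h => (hi h).1) (fun h s hs => hne1 _ ((hj h).1 s hs))
      (fun h s hs => hnep _ ((hk h).1 s hs)), circleRes_succ_k hp0 hp1 ha]
    ring
  · intro i hi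
    have h := hγ.loopIntegral_sub_zpow (b := 0) (n := i) (fun h => (hi h).1)
    have e : ratFun p i 0 0 = fun z => (z - 0) ^ i := by
      ext z
      simp [ratFun]
    rw [e, h]
    rcases ha with rfl | rfl
    · rw [circleRes_zero_pow hp1]
      split_ifs with h1
      · rw [(hi (by omega)).2, if_pos rfl, sub_self]
      · exact sub_self _
    · rw [circleRes_neg_one_of_nonneg hp0 hp1 le_rfl, sub_zero]
      split_ifs with h1
      · rw [(hi (by omega)).2, if_neg (by norm_num)]
      · rfl
  · intro j hj
    have h := hγ.loopIntegral_sub_zpow (b := -1) (n := j) (fun h => (hj h).1)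
    have e : ratFun p 0 j 0 = fun z => (z - -1) ^ j := by
      ext z
      simp [ratFun, add_comm]
    rw [e, h]
    rcases ha with rfl | rfl
    · rw [circleRes_zero_of_nonneg hp0 hp1 le_rfl, sub_zero]
      split_ifs with h1
      · rw [(hj (by omega)).2, if_neg (by norm_num)]
      · rfl
    · rw [circleRes_neg_one_pow hp1]
      split_ifs with h1
      · rw [(hj (by omega)).2, if_pos rfl, sub_self]
      · exact sub_self _
  · intro k hk
    have h := hγ.loopIntegral_sub_zpow (b := -(p : ℂ)⁻¹) (n := k) (fun h => (hk h).1)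
    have e : loopIntegral (ratFun p 0 0 k) γ =
        (p : ℂ) ^ k * loopIntegral (fun z => (z - -(p : ℂ)⁻¹) ^ k) γ := by
      simp only [loopIntegral]
      rw [← intervalIntegral.integral_const_mul]
      congr 1
      ext s
      rw [← mul_assoc, ← mul_zpow, sub_neg_eq_add, mul_add, mul_inv_cancel₀ hp, add_comm]
      simp [ratFun]
    have hc : circleRes p a 0 0 k = 0 := by
      rcases ha with rfl | rfl
      · exact circleRes_zero_of_nonneg hp0 hp1 le_rfl _ _
      · exact circleRes_neg_one_of_nonneg hp0 hp1 le_rfl _ _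
    rw [e, hc, sub_zero, mul_left_comm, h]
    split_ifs with h1
    · rw [(hk (by omega)).2, mul_zero]
    · exact mul_zero _

end

theorem isPole_of_eventuallyEq {f g : ℂ → ℂ} {b : ℂ} {n : ℤ} (hn : n < 0)
    (hg : AnalyticAt ℂ g b) (hgb : g b ≠ 0)
    (h : ∀ᶠ z in nhdsWithin b {b}ᶜ, f z = (z - b) ^ n * g z) : IsPole f b := by
  have hm : MeromorphicAt f b := by
    refine MeromorphicAt.congr ?_ (Filter.EventuallyEq.symm h)
    exact (((MeromorphicAt.id b).sub (MeromorphicAt.const b b)).zpow n).mul hg.meromorphicAt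
  rw [IsPole, (meromorphicOrderAt_eq_int_iff hm).2 ⟨g, hg, hgb, h⟩]
  exact_mod_cast hn

section
variable {p : ℝ} (hp0 : 0 < p) (hp1 : p < 1)
include hp0 hp1

/-- The points `0`, `-1`, `-1/p` are distinct, so nothing cancels a negative exponent. Thus the
conditions of `IsContourAround` on poles supply the hypotheses of
`IsSimpleLoop.loopIntegral_ratFun`. -/
theorem isPole_ratFun {f : ℂ → ℂ} {c : ℂ} (hc : c ≠ 0) {i j k : ℤ} {b : ℂ}
    (h : ∀ᶠ z in nhdsWithin b {b}ᶜ, f z = c * ratFun p i j k z) :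
    (b = 0 → i < 0 → IsPole f b) ∧ (b = -1 → j < 0 → IsPole f b) ∧
      (b = -(p : ℂ)⁻¹ → k < 0 → IsPole f b) := by
  have hp : (p : ℂ) ≠ 0 := Complex.ofReal_ne_zero.2 hp0.ne'
  have hp1' : (1 : ℂ) - p ≠ 0 := one_sub_ofReal_ne_zero hp1
  have a0 : AnalyticAt ℂ (fun z : ℂ => z) b := analyticAt_id
  have a1 : AnalyticAt ℂ (fun z : ℂ => 1 + z) b := analyticAt_const.add analyticAt_id
  have a2 : AnalyticAt ℂ (fun z : ℂ => 1 + (p : ℂ) * z) b :=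
    analyticAt_const.add (analyticAt_const.mul analyticAt_id)
  refine ⟨?_, ?_, ?_⟩
  · rintro rfl hi
    refine isPole_of_eventuallyEq (g := fun z => c * ((1 + z) ^ j * (1 + p * z) ^ k)) hi
      (analyticAt_const.mul ((a1.zpow (by simp)).mul (a2.zpow (by simp)))) (by simp [hc]) ?_
    filter_upwards [h] with z hz
    rw [hz, ratFun, sub_zero]
    ring
  · rintro rfl hj
    have h1 : 1 + (p : ℂ) * -1 ≠ 0 := by
      rw [mul_neg_one, ← sub_eq_add_neg]
      exact hp1'
    refine isPole_of_eventuallyEq (g := fun z => c * (z ^ i * (1 + p * z) ^ k)) hj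
      (analyticAt_const.mul ((a0.zpow (by simp)).mul (a2.zpow h1)))
      (mul_ne_zero hc (mul_ne_zero (zpow_ne_zero _ (by simp)) (zpow_ne_zero _ h1))) ?_
    filter_upwards [h] with z hz
    rw [hz, ratFun, sub_neg_eq_add, add_comm z 1]
    ring
  · rintro rfl hk
    have h0 : -(p : ℂ)⁻¹ ≠ 0 := neg_ne_zero.2 (inv_ne_zero hp)
    have h1 : 1 + -(p : ℂ)⁻¹ ≠ 0 := by
      intro h
      apply hp1'
      field_simp at h
      linear_combination -h
    refine isPole_of_eventuallyEq (g := fun z => c * (z ^ i * (1 + z) ^ j * (p : ℂ) ^ k)) hk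
      (analyticAt_const.mul (((a0.zpow h0).mul (a1.zpow h1)).mul analyticAt_const))
      (mul_ne_zero hc (mul_ne_zero (mul_ne_zero (zpow_ne_zero _ h0) (zpow_ne_zero _ h1))
        (zpow_ne_zero _ hp))) ?_
    filter_upwards [h] with z hz
    have e : 1 + (p : ℂ) * z = (z - -(p : ℂ)⁻¹) * p := by
      field_simp
      ring
    rw [hz, ratFun, e, mul_zpow]
    ring

theorem kTildeTASEP_eq {γ : ℝ → ℂ} {u v : (ℤ × ℕ) × ℤ}
    (h : IsContourAround (kTildeIntegrand p u v) 0 γ) : kTildeTASEP p γ u v = kRes p u v := by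
  obtain ⟨⟨n₁, t₁⟩, x₁⟩ := u
  obtain ⟨⟨n₂, t₂⟩, x₂⟩ := v
  set r := x₁ + n₁ + n₂ with hr
  set c : ℂ := (-1) ^ (r + 1) * (1 - (p : ℂ)) ^ ((t₁ : ℤ) - 2 * n₁ - x₁) with hc
  have hc0 : c ≠ 0 := mul_ne_zero (zpow_ne_zero _ (by norm_num))
    (zpow_ne_zero _ (one_sub_ofReal_ne_zero hp1))
  have hf : ∀ z, kTildeIntegrand p ((n₁, t₁), x₁) ((n₂, t₂), x₂) z =
      c * ratFun p (-r - 1) (x₂ + n₁ + n₂) (r - (t₁ + t₂) - 1) z := by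
    intro z
    have e1 : (-z) ^ (r + 1) = (-1) ^ (r + 1) * z ^ (r + 1) := by
      rw [← mul_zpow, neg_one_mul]
    have e2 : ((-1 : ℂ) ^ (r + 1))⁻¹ = (-1) ^ (r + 1) := by
      rw [← inv_zpow]
      norm_num
    have e3 : z ^ (-r - 1) = (z ^ (r + 1))⁻¹ := by
      rw [← zpow_neg]
      congr 1
      ring
    have e4 : (1 + (p : ℂ) * z) ^ (r - (t₁ + t₂) - 1) =
        ((1 + (p : ℂ) * z) ^ ((t₁ : ℤ) + t₂ + 1 - r))⁻¹ := by
      rw [← zpow_neg]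
      congr 1
      ring
    simp only [kTildeIntegrand, ratFun, ← hr]
    rw [e3, e4, e1, div_eq_mul_inv, div_eq_mul_inv, mul_inv, e2, hc]
    ring
  have hpole := fun b => isPole_ratFun hp0 hp1 (b := b) hc0 (Filter.Eventually.of_forall hf)
  have hp : (p : ℂ) ≠ 0 := Complex.ofReal_ne_zero.2 hp0.ne'
  have hres := h.isSimpleLoop.loopIntegral_ratFun hp0 hp1 (Or.inl rfl)
    (i := -r - 1) (j := x₂ + n₁ + n₂) (k := r - (t₁ + t₂) - 1)
    (fun _ => ⟨h.avoids_center, by rw [if_pos rfl]; exact h.encloses_center⟩)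
    (fun hj => by
      have := (hpole (-1)).2.1 rfl hj
      refine ⟨fun s hs hs' => h.avoids_poles s hs (hs' ▸ this), ?_⟩
      rw [if_neg (by norm_num)]
      exact h.excludes_poles _ (by norm_num) this)
    (fun hk => by
      have := (hpole (-(p : ℂ)⁻¹)).2.2 rfl hk
      exact ⟨fun s hs hs' => h.avoids_poles s hs (hs' ▸ this),
        h.excludes_poles _ (neg_ne_zero.2 (inv_ne_zero hp)) this⟩)
  have hloop : loopIntegral (kTildeIntegrand p ((n₁, t₁), x₁) ((n₂, t₂), x₂)) γ =
      c * loopIntegral (ratFun p (-r - 1) (x₂ + n₁ + n₂) (r - (t₁ + t₂) - 1)) γ := by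
    simp only [loopIntegral]
    rw [← intervalIntegral.integral_const_mul]
    simp only [hf, mul_assoc]
  rw [kTildeTASEP, hloop, kRes, kCoeff]
  simp only
  rw [← hr, ← hres, hc, neg_one_zpow_add_one, div_eq_mul_inv]
  ring

theorem phiTASEP_eq {γ : ℝ → ℂ} {u v : (ℤ × ℕ) × ℤ} (huv : SpaceLikeLE u.1 v.1)
    (h : IsContourAround (phiIntegrand p u v) (-1) γ) : phiTASEP p γ u v = phiRes p u v := by
  obtain ⟨⟨n₁, t₁⟩, x₁⟩ := u
  obtain ⟨⟨n₂, t₂⟩, x₂⟩ := v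
  obtain ⟨hn, ht⟩ := huv
  simp only at hn ht
  -- Space-like order makes `d` and `τ` natural numbers, so `1 + p w` has exponent `τ + d ≥ 0` and
  -- `-1/p` is not a pole.
  obtain ⟨d, hd⟩ := Int.le.dest hn
  obtain ⟨τ, hτ⟩ := Nat.exists_eq_add_of_le ht
  have hd1 : n₁ - n₂ = -(d : ℤ) := by omega
  have hd2 : n₂ - n₁ = (d : ℤ) := by omega
  have hτ1 : (t₁ : ℤ) - t₂ = τ := by omega
  set c : ℂ := (-1) ^ (d : ℤ) with hc
  have hc0 : c ≠ 0 := zpow_ne_zero _ (by norm_num)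
  -- At `-1` powers of the zero factor `1 + z` need not combine; the contour avoids this point.
  have hf : ∀ z ≠ -1, phiIntegrand p ((n₁, t₁), x₁) ((n₂, t₂), x₂) z =
      c * ratFun p (-d) (d - (x₁ - x₂) - 1) (τ + d) z := by
    intro z hz
    have hz1 : 1 + z ≠ 0 := fun h => hz (by linear_combination h)
    have e1 : (1 + z) ^ ((d : ℤ) - (x₁ - x₂) - 1) = (1 + z) ^ d / (1 + z) ^ (x₁ - x₂ + 1) := by
      rw [← zpow_natCast, ← zpow_sub₀ hz1]
      congr 1
      ring
    simp only [phiIntegrand, ratFun]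
    rw [hd1, hτ1, e1, hc, show (τ : ℤ) + d = ((τ + d : ℕ) : ℤ) by push_cast; rfl]
    simp only [zpow_neg, zpow_natCast, div_pow, mul_pow, pow_add, inv_div]
    rw [neg_pow z, div_eq_mul_inv _ ((-1) ^ d * z ^ d), mul_inv, ← inv_pow (-1 : ℂ)]
    norm_num
    ring
  have hpole : 0 < d → IsPole (phiIntegrand p ((n₁, t₁), x₁) ((n₂, t₂), x₂)) 0 := fun hd0 => by
    refine (isPole_ratFun hp0 hp1 (i := -d) (j := d - (x₁ - x₂) - 1) (k := τ + d) (b := 0) hc0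
      ?_).1 rfl (by omega)
    have : ∀ᶠ z in nhds (0 : ℂ), z ≠ -1 := isOpen_ne.mem_nhds (by simp)
    filter_upwards [nhdsWithin_le_nhds this] with z hz using hf z hz
  have hres := h.isSimpleLoop.loopIntegral_ratFun hp0 hp1 (Or.inr rfl)
    (i := -d) (j := d - (x₁ - x₂) - 1) (k := τ + d)
    (fun hi => by
      have := hpole (by omega)
      refine ⟨fun s hs hs' => h.avoids_poles s hs (hs' ▸ this), ?_⟩
      rw [if_neg (by norm_num)]
      exact h.excludes_poles _ (by norm_num) this)
    (fun _ => ⟨h.avoids_center, by rw [if_pos rfl]; exact h.encloses_center⟩)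
    (fun hk => absurd hk (by omega))
  have hloop : loopIntegral (phiIntegrand p ((n₁, t₁), x₁) ((n₂, t₂), x₂)) γ =
      c * loopIntegral (ratFun p (-d) (d - (x₁ - x₂) - 1) (τ + d)) γ := by
    simp only [loopIntegral]
    rw [← intervalIntegral.integral_const_mul]
    refine intervalIntegral.integral_congr fun s hs => ?_
    rw [Set.uIcc_of_le zero_le_one] at hs
    simp only [hf _ (h.avoids_center s hs), mul_assoc]
  rw [phiTASEP, hloop, phiRes, phiCoeff]
  simp only
  rw [hd2, hτ1, ← hres, hc, one_div]
  ring

theorem one_sub_kernelTASEP {Γ₁ Γ₀ : (ℤ × ℕ) × ℤ → (ℤ × ℕ) × ℤ → ℝ → ℂ}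
    (hΓ₁ : ∀ u v, IsContourAround (phiIntegrand p u v) (-1) (Γ₁ u v))
    (hΓ₀ : ∀ u v, IsContourAround (kTildeIntegrand p u v) 0 (Γ₀ u v)) (u v : (ℤ × ℕ) × ℤ) :
    (if u = v then 1 else 0) - kernelTASEP p Γ₁ Γ₀ u v = complKernel p u v := by
  rw [kernelTASEP, complKernel, kTildeTASEP_eq hp0 hp1 (hΓ₀ u v)]
  obtain ⟨c, x⟩ := u
  obtain ⟨c', x'⟩ := v
  by_cases hc : c = c'
  · subst hc
    rw [if_neg (fun h : SpaceLikePrec c c => h.2.2 rfl), if_pos (show SpaceLikeLE c c from ⟨le_rfl, le_rfl⟩),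
      phiRes_self hp1]
    simp
  · rw [if_neg (fun h => hc (congrArg Prod.fst h))]
    by_cases hle : SpaceLikeLE c c'
    · rw [if_pos (show SpaceLikePrec c c' from ⟨hle.1, hle.2, hc⟩), if_pos hle,
        phiTASEP_eq hp0 hp1 hle (hΓ₁ _ _)]
      ring
    · rw [if_neg (fun h : SpaceLikePrec c c' => hle ⟨h.1, h.2.1⟩), if_neg hle]
      ring

end

/-! ### The Fredholm series of an effectively finite kernel -/

theorem det_one_add_eq_sum_minors {ι : Type*} [Fintype ι] [DecidableEq ι] (M : Matrix ι ι ℂ) :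
    (1 + M).det = ∑ s : Finset ι, (M.submatrix (Subtype.val : s → ι) (Subtype.val : s → ι)).det := by
  rw [add_comm]
  change Matrix.detRowAlternating ((fun i => M i) + fun i => (1 : Matrix ι ι ℂ) i) = _
  rw [AlternatingMap.map_add_univ]
  exact Finset.sum_congr rfl fun s _ => Matrix.det_piecewise_one_eq_submatrix_det M s

/-- A tuple with a repetition has two equal rows and contributes zero; each `n`-element subset has
`n!` enumerations, all with the same minor. -/
theorem sum_det_tuples {ι : Type*} [Fintype ι] [DecidableEq ι] (M : Matrix ι ι ℂ) (n : ℕ) :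
    ∑ y : Fin n → ι, (M.submatrix y y).det = n.factorial *
      ∑ s ∈ Finset.univ.powersetCard n,
        (M.submatrix (Subtype.val : s → ι) (Subtype.val : s → ι)).det := by
  have h0 : ∀ y : Fin n → ι, Finset.univ.image y ∉ Finset.univ.powersetCard n →
      (M.submatrix y y).det = 0 := by
    intro y hy
    have : ¬ Function.Injective y := fun hinj => hy (by
      rw [Finset.mem_powersetCard_univ, Finset.card_image_of_injective _ hinj, Finset.card_univ,
        Fintype.card_fin])
    simp only [Function.Injective, not_forall] at this
    obtain ⟨i, j, hij, hne⟩ := this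
    exact Matrix.det_zero_of_row_eq hne (by ext k; simp [hij])
  have h1 : ∑ y : Fin n → ι, (M.submatrix y y).det =
      ∑ y ∈ Finset.univ.filter fun y : Fin n → ι =>
        Finset.univ.image y ∈ Finset.univ.powersetCard n, (M.submatrix y y).det := by
    rw [Finset.sum_filter]
    refine Finset.sum_congr rfl fun y _ => ?_
    split_ifs with h
    · rfl
    · exact h0 y h
  rw [h1, ← Finset.sum_fiberwise_of_maps_to
    (t := Finset.univ.powersetCard n) (g := fun y : Fin n → ι => Finset.univ.image y)
    (fun y hy => (Finset.mem_filter.1 hy).2), Finset.mul_sum]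
  refine Finset.sum_congr rfl fun s hs => ?_
  have hcard : s.card = n := Finset.mem_powersetCard_univ.1 hs
  have h2 : ∑ e : Fin n ≃ s, (M.submatrix (Subtype.val : s → ι) (Subtype.val : s → ι)).det =
      n.factorial * (M.submatrix (Subtype.val : s → ι) (Subtype.val : s → ι)).det := by
    rw [Finset.sum_const, Finset.card_univ,
      Fintype.card_equiv (Fintype.equivOfCardEq (by simp [hcard])), Fintype.card_fin, nsmul_eq_mul]
  rw [← h2]
  symm
  refine Finset.sum_bij (fun (e : Fin n ≃ s) _ => fun i => (e i : ι)) ?_ ?_ ?_ ?_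
  · intro e _
    have : Finset.univ.image (fun i => (e i : ι)) = s := by
      ext x
      simp only [Finset.mem_image, Finset.mem_univ, true_and]
      constructor
      · rintro ⟨i, rfl⟩
        exact (e i).2
      · exact fun hx => ⟨e.symm ⟨x, hx⟩, by simp⟩
    simp only [Finset.mem_filter, Finset.mem_univ, true_and, this, hs]
  · intro e _ e' _ h
    ext i
    exact congrFun h i
  · intro y hy
    simp only [Finset.mem_filter, Finset.mem_univ, true_and] at hy
    have hmem : ∀ i, y i ∈ s := fun i => hy.2 ▸ Finset.mem_image_of_mem y (Finset.mem_univ i)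
    have hbij : Function.Bijective (fun i => (⟨y i, hmem i⟩ : s)) := by
      rw [Fintype.bijective_iff_surjective_and_card]
      refine ⟨fun ⟨x, hx⟩ => ?_, by simp [hcard]⟩
      rw [← hy.2] at hx
      obtain ⟨i, -, hi⟩ := Finset.mem_image.1 hx
      exact ⟨i, Subtype.ext hi⟩
    exact ⟨Equiv.ofBijective _ hbij, Finset.mem_univ _, rfl⟩
  · intro e _
    rw [← Matrix.det_submatrix_equiv_self e]
    rfl

/-- If the determinants in the Fredholm series vanish outside of a finite set `W`, then the
Fredholm determinant is the determinant of a finite matrix. -/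
theorem hasFredholmDet_of_finite {X : Type*} [DecidableEq X] {L : X → X → ℂ} (W : Finset X)
    (h : ∀ (n : ℕ) (y : Fin n → X), (∃ i, y i ∉ W) →
      Matrix.det (Matrix.of fun i j : Fin n => L (y i) (y j)) = 0) :
    HasFredholmDet L (minorDet (fun u v => (if u = v then 1 else 0) - L u v) W) := by
  set M : Matrix W W ℂ := Matrix.of fun i j => L i j with hM
  have hdet : minorDet (fun u v => (if u = v then 1 else 0) - L u v) W =
      ∑ n ∈ Finset.range (W.card + 1), (-1 : ℂ) ^ n / (n.factorial : ℂ) *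
        ∑ y : Fin n → W, (M.submatrix y y).det := by
    have h1 : minorDet (fun u v => (if u = v then 1 else 0) - L u v) W = (1 + -M).det := by
      rw [minorDet]
      congr 1
      ext i j
      rw [Matrix.add_apply, Matrix.neg_apply, Matrix.one_apply, ← sub_eq_add_neg]
      simp only [Subtype.ext_iff]
      rfl
    rw [h1, det_one_add_eq_sum_minors, ← Finset.powerset_univ, Finset.sum_powerset]
    rw [Finset.card_univ, Fintype.card_coe]
    refine Finset.sum_congr rfl fun n _ => ?_
    rw [sum_det_tuples, ← mul_assoc, div_mul_cancel₀ _ (by exact_mod_cast n.factorial_ne_zero),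
      Finset.mul_sum]
    refine Finset.sum_congr rfl fun s hs => ?_
    rw [Matrix.submatrix_neg, Pi.neg_apply, Pi.neg_apply, Matrix.det_neg, Fintype.card_coe,
      Finset.mem_powersetCard_univ.1 hs]
  rw [hdet]
  set F : Finset (Σ n : ℕ, (Fin n → X)) :=
    (Finset.range (W.card + 1)).sigma fun n => Fintype.piFinset fun _ => W with hF
  have hsum : ∑ n ∈ Finset.range (W.card + 1), (-1 : ℂ) ^ n / (n.factorial : ℂ) *
        ∑ y : Fin n → W, (M.submatrix y y).det = ∑ y ∈ F, (-1 : ℂ) ^ y.1 / (y.1.factorial : ℂ) *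
      Matrix.det (Matrix.of fun i j : Fin y.1 => L (y.2 i) (y.2 j)) := by
    rw [hF, Finset.sum_sigma]
    refine Finset.sum_congr rfl fun n _ => ?_
    rw [Finset.mul_sum]
    refine Finset.sum_bij (fun (y : Fin n → W) _ i => (y i : X)) ?_ ?_ ?_ ?_
    · intro y _
      simp
    · intro y _ y' _ hyy
      ext i
      exact congrFun hyy i
    · intro y hy
      rw [Fintype.mem_piFinset] at hy
      exact ⟨fun i => ⟨y i, hy i⟩, Finset.mem_univ _, rfl⟩
    · intro y _
      rfl
  rw [hsum]
  refine hasSum_sum_of_ne_finset_zero fun ⟨n, y⟩ hy => ?_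
  simp only
  by_cases hW : ∃ i, y i ∉ W
  · rw [h n y hW, mul_zero]
  · push Not at hW
    -- Such a tuple has more entries than `W` has points, hence a repeated one.
    have hn : W.card < n := by
      by_contra hcon
      exact hy (Finset.mem_sigma.2 ⟨Finset.mem_range.2 (by simp only; omega),
        Fintype.mem_piFinset.2 hW⟩)
    obtain ⟨i, -, j, -, hne, hij⟩ := Finset.exists_ne_map_eq_of_card_lt_of_maps_to
      (s := (Finset.univ : Finset (Fin n))) (t := W) (by simpa using hn) (fun i _ => hW i)
    rw [Matrix.det_zero_of_row_eq hne (by ext k; simp [hij]), mul_zero]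

end

/-! ### The theorem: reduction of the Fredholm determinant to a window -/

theorem theorem1 {Ω : Type*} [MeasurableSpace Ω] (P : Measure Ω) [IsProbabilityMeasure P]
    (p : ℝ) (hp0 : 0 < p) (hp1 : p < 1)
    (x : ℤ → ℕ → Ω → ℤ) (hx : IsParallelTASEP P p (fun i => -2 * i) x)
    (m : ℕ) (S : Fin m → ℤ × ℕ) (hS : ∀ k l : Fin m, k < l → SpaceLikePrec (S k) (S l))
    (a : Fin m → ℤ)
    (Γ₁ Γ₀ : (ℤ × ℕ) × ℤ → (ℤ × ℕ) × ℤ → ℝ → ℂ)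
    (hΓ₁ : ∀ u v, IsContourAround (phiIntegrand p u v) (-1) (Γ₁ u v))
    (hΓ₀ : ∀ u v, IsContourAround (kTildeIntegrand p u v) 0 (Γ₀ u v)) :
    HasFredholmDet
      (fun u v : Fin m × ℤ =>
        chiBelow a u * kernelTASEP p Γ₁ Γ₀ (S u.1, u.2) (S v.1, v.2) * chiBelow a v)
      ((P.real (⋂ k : Fin m, {ω | a k ≤ x (S k).1 (S k).2 ω}) : ℝ) : ℂ) := by
  obtain ⟨ξ, hm, hi, hp, hdyn⟩ := hx
  have hinj : Function.Injective S := by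
    intro k l hkl
    rcases lt_trichotomy k l with h | h | h
    · exact absurd hkl (hS k l h).2.2
    · exact h
    · exact absurd hkl.symm (hS l k h).2.2
  have hle : ∀ k l, k ≤ l → SpaceLikeLE (S k) (S l) := fun k l hkl => by
    rcases hkl.eq_or_lt with rfl | h
    · exact ⟨le_rfl, le_rfl⟩
    · exact ⟨(hS k l h).1, (hS k l h).2.1⟩
  obtain ⟨N, hN⟩ : ∃ N, ∀ k, (S k).1 ≤ N := by
    obtain ⟨N, hN⟩ := (Set.finite_range fun k => (S k).1).bddAbove
    exact ⟨N, fun k => hN ⟨k, rfl⟩⟩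
  -- `S` is injective, so the bounds become a function of the point; the value `0` off the chain
  -- plays no role.
  set b : ℤ × ℕ → ℤ := Function.extend S a 0 with hb
  have hbS : ∀ k, b (S k) = a k := fun k => hinj.extend_apply _ _ _
  set T : Finset (ℤ × ℕ) := Finset.univ.image S with hT
  have hchain : IsSpaceLikeChain T := by
    intro c hc c' hc'
    obtain ⟨k, -, rfl⟩ := Finset.mem_image.1 hc
    obtain ⟨l, -, rfl⟩ := Finset.mem_image.1 hc'
    exact (le_total k l).imp (hle k l) (hle l k)
  have hTN : ∀ c ∈ T, c.1 ≤ N := by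
    intro c hc
    obtain ⟨k, -, rfl⟩ := Finset.mem_image.1 hc
    exact hN k
  have hprob : P.real (⋂ k : Fin m, {ω | a k ≤ x (S k).1 (S k).2 ω}) =
      P.real (tasepEvent ξ T b) := by
    refine measureReal_congr ?_
    filter_upwards [hdyn] with ω hω
    have hx := fun t => eq_tasepPos ξ hω.1 hω.2 t
    refine propext ?_
    change ω ∈ (⋂ k : Fin m, {ω | a k ≤ x (S k).1 (S k).2 ω}) ↔ ω ∈ tasepEvent ξ T b
    simp [tasepEvent, hT, hbS, hx]
  rw [hprob, ← gapDet_eq_measureReal hp0 hp1 hm hi hp hchain hTN b]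
  set emb : Fin m × ℤ → (ℤ × ℕ) × ℤ := fun u => (S u.1, u.2) with hemb
  have hembinj : Function.Injective emb := by
    rintro ⟨k, y⟩ ⟨l, z⟩ h
    simp only [hemb, Prod.mk.injEq] at h
    rw [hinj h.1, h.2]
  set W : Finset (Fin m × ℤ) := (window N T b).preimage emb hembinj.injOn with hW
  have memW : ∀ u, u ∈ W ↔ -N - (S u.1).1 ≤ u.2 ∧ u.2 < a u.1 := fun u => by
    rw [hW, Finset.mem_preimage, mem_window]
    simp [hemb, hT, hbS]
  set L : Fin m × ℤ → Fin m × ℤ → ℂ := fun u v =>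
    chiBelow a u * kernelTASEP p Γ₁ Γ₀ (S u.1, u.2) (S v.1, v.2) * chiBelow a v with hL
  have hker : ∀ u v : Fin m × ℤ, (if u = v then 1 else 0) -
      kernelTASEP p Γ₁ Γ₀ (S u.1, u.2) (S v.1, v.2) = complKernel p (emb u) (emb v) := by
    intro u v
    rw [← one_sub_kernelTASEP hp0 hp1 hΓ₁ hΓ₀]
    simp only [hembinj.eq_iff]
    rfl
  have hgap : gapDet p N T b = minorDet (fun u v => (if u = v then 1 else 0) - L u v) W := by
    have e : ∀ u, u ∈ W ↔ emb u ∈ window N T b := fun u => by rw [hW, Finset.mem_preimage]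
    have hbij : Function.Bijective
        (fun u : W => (⟨emb u, (e u).1 u.2⟩ : window N T b)) := by
      constructor
      · intro u v h
        exact Subtype.ext (hembinj (Subtype.ext_iff.1 h))
      · rintro ⟨⟨c, y⟩, hu⟩
        obtain ⟨k, -, hk⟩ := Finset.mem_image.1 (mem_window.1 hu).1
        simp only at hk
        subst hk
        exact ⟨⟨(k, y), (e _).2 hu⟩, rfl⟩
    rw [gapDet, minorDet, minorDet,
      ← Matrix.det_submatrix_equiv_self (Equiv.ofBijective _ hbij)]
    congr 1
    ext ⟨u, hu⟩ ⟨v, hv⟩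
    have hu' : chiBelow a u = 1 := if_pos ((memW u).1 hu).2
    have hv' : chiBelow a v = 1 := if_pos ((memW v).1 hv).2
    simp [hL, hu', hv', hker]
  rw [hgap]
  refine hasFredholmDet_of_finite W fun n y hy => ?_
  by_cases hhigh : ∃ i, ¬ (y i).2 < a (y i).1
  · obtain ⟨i, hi⟩ := hhigh
    refine Matrix.det_eq_zero_of_row_eq_zero i fun j => ?_
    have : chiBelow a (y i) = 0 := if_neg hi
    simp [hL, this]
  · push Not at hhigh
    obtain ⟨i₀, hi₀⟩ := hy
    -- Among the entries left of the window, one of largest chain index has a zero row: `K̃`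
    -- vanishes there, `φ` vanishes against points of the window, and the other low entries have no
    -- larger index, so `K` contains no `φ` against them.
    obtain ⟨i, hi, hmax⟩ := (Finset.univ.filter fun i => y i ∉ W).exists_max_image
      (fun i => (y i).1) ⟨i₀, by simp [hi₀]⟩
    simp only [Finset.mem_filter, Finset.mem_univ, true_and] at hi hmax
    have hlow : ∀ j, y j ∉ W → (y j).2 + (S (y j).1).1 < -N := fun j hj => by
      by_contra hcon
      exact hj ((memW _).2 ⟨by omega, hhigh j⟩)
    have hi' := hlow i hi
    refine Matrix.det_eq_zero_of_row_eq_zero i fun j => ?_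
    have hk := hker (y i) (y j)
    have hzero : kernelTASEP p Γ₁ Γ₀ (S (y i).1, (y i).2) (S (y j).1, (y j).2) = 0 := by
      by_cases hjW : y j ∈ W
      · rw [if_neg (ne_of_mem_of_not_mem hjW hi).symm, complKernel_eq_zero_of_low hp0 hp1 (hN _)
          (by have := ((memW _).1 hjW).1; simp only [hemb]; omega) hi'] at hk
        linear_combination -hk
      · have hjN := hN (y j).1
        rw [complKernel, kRes_eq_zero hp0 hp1 (by simp only [hemb]; omega), sub_zero] at hk
        rcases (hmax j hjW).eq_or_lt with h | h
        · rw [show emb (y i) = (S (y i).1, (y i).2) from rfl,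
            show emb (y j) = (S (y i).1, (y j).2) by simp only [hemb, h],
            if_pos (show SpaceLikeLE _ _ from ⟨le_rfl, le_rfl⟩), phiRes_self hp1] at hk
          by_cases h2 : (y i).2 = (y j).2
          · rw [if_pos h2, if_pos (Prod.ext h.symm h2)] at hk
            linear_combination -hk
          · rw [if_neg h2, if_neg (fun h3 => h2 (congrArg Prod.snd h3))] at hk
            linear_combination -hk
        · have hprec := hS _ _ h
          rw [if_neg (fun h3 => h.ne (congrArg Prod.fst h3).symm), if_neg] at hk
          · linear_combination -hk
          · intro h3
            exact hprec.2.2 (Prod.ext (le_antisymm hprec.1 h3.1) (le_antisymm h3.2 hprec.2.1))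
    simp [hL, hzero]
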